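/- Let $A,B$ be $\mathbb Z/2$-graded $C^*$-algebras and let $(\mathcal E,D)$ be an unbounded $KK$-cycle for $(A,B)$: $\mathcal E$ is a graded right $C^*$-module over $B$ with a graded $*$-homomorphism $A\to \mathrm{End}^*_B(\mathcal E)$ (written $a\mapsto a$), $D$ is an odd selfadjoint regular operator in $\mathcal E$, $a(1+D^2)^{-1}\in\mathbb K_B(\mathcal E)$ for all $a\in A$, and $\mathcal A_1=\{a\in A:[D,a]\in \mathrm{End}^*_B(\mathcal E)\}$ is dense in $A$. All commutators are graded, and "$[D,T]\in \mathrm{End}^*_B$" means that $T$ preserves $\mathrm{Dom}\,D$ and that $[D,T]$ extends from $\mathrm{Dom}\,D$ to an adjointable operator. Put $\mathcal E_0=\mathcal E$, $\mathcal E_{n+1}=\mathcal E_n\oplus\mathcal E_n$, let $D$ act diagonally in each $\mathcal E_n$, and let $$p_{n+1}=\begin{pmatrix}(1+D^2)^{-1}&D(1+D^2)^{-1}\\ D(1+D^2)^{-1}&D^2(1+D^2)^{-1}\end{pmatrix}\in \mathrm{End}_B^*(\mathcal E_n\oplus\mathcal E_n)$$ be the projection onto the graph of $D$ in $\mathcal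 E_n$; write $p_n$ also for $p_n\oplus p_n$ on $\mathcal E_{n+1}$, and $p^\perp=1-p$. Let $\mathcal A_0=A$, $\theta_0(a)=a$, and define inductively, for $n\ge 0$, $$\mathcal A_{n+1}=\{a\in\mathcal A_n:[D,\theta_n(a)]\in \mathrm{End}^*_B(\mathcal E_n)\},\qquad \pi_{n+1}(a)=\begin{pmatrix}\theta_n(a)&0\\ [D,\theta_n(a)]&(-1)^{\partial a}\theta_n(a)\end{pmatrix}\quad(a\in\mathcal A_{n+1}),$$ $$\theta_1(a)=p_1\pi_1(a)p_1+p_1^\perp\pi_1(a)p_1^\perp,\qquad \theta_{n+1}(a)=p_{n+1}p_n\pi_{n+1}(a)p_np_{n+1}+p_{n+1}^\perp p_n^\perp\pi_{n+1}(a)p_n^\perp p_{n+1}^\perp\quad(n\ge1).$$ Here $(-1)^{\partial a}\theta_n(a)$ is extended linearly to inhomogeneous $a$, that is, it denotes $\theta_n$ of the image of $a$ under the grading automorphism. The set $\mathcal A_n$ is called the $n$-th Sobolev subalgebra of $A$, and the cycle is called $C^k$ if $\mathcal A_k$ is dense in $A$. **Theorem.** Let $k\ge 0$. If $(\mathcal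 E,D)$ is $C^k$, then for every $i\le k$ the set $\mathcal A_i$ is a subalgebra of $A$ that is stable under holomorphic functional calculus in $A$. That is: if $A$ is unital, then $f(a)\in\mathcal A_i$ for every $a\in\mathcal A_i$ and every function $f$ that is holomorphic on an open neighbourhood of the spectrum of $a$ in $A$; and, whether or not $A$ is unital, $f(b)\in\mathbb C\oplus\mathcal A_i$ for every $b\in\mathbb C\oplus\mathcal A_i$ in the unitization $\mathbb C\oplus A$ and every $f$ that is holomorphic on an open neighbourhood of the spectrum of $b$ in $\mathbb C\oplus A$. Here $f(a)=\frac1{2\pi i}\oint_\Gamma f(z)(z-a)^{-1}\,dz$, where $\Gamma$ is a cycle of $C^1$ paths in the domain of $f$, off the spectrum of $a$, with winding number $1$ around each point of the spectrum and $0$ around each point outside the domain. -/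

import Mathlib

/-! ## Graded C*-algebras, right C*-modules, regular operators

A right C*-module over `B` is a Mathlib `CStarModule` over the opposite algebra `Bᵐᵒᵖ`
(complete, with the norm given by the inner product). The action `e b` is `op b • e`, and the rule
`⟨e₁, e₂ b⟩ = ⟨e₁, e₂⟩ b` is `CStarModule.inner_op_smul_right`; the `B`-valued inner product is
`unop (inner Bᵐᵒᵖ e₁ e₂)`. -/

namespace KKSobolev

/-- A `ℤ/2`-grading of a C*-algebra, given by its grading automorphism
(`a ↦ (-1)^{∂a} a` on homogeneous elements). -/
structure Grading (A : Type*) [NonUnitalCStarAlgebra A] where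
  aut : A ≃⋆ₐ[ℂ] A
  aut_aut : ∀ a, aut (aut a) = a

section Module

variable (B : Type*) {E : Type*} [NonUnitalCStarAlgebra B] [PartialOrder B] [StarOrderedRing B]
  [NormedAddCommGroup E] [NormedSpace ℂ E] [SMul Bᵐᵒᵖ E] [CStarModule Bᵐᵒᵖ E]

/-- `X` is an adjointable endomorphism of the C*-module `⨁_{i ∈ ι} E`, whose inner product is
`⟨x, y⟩ = ∑ i, ⟨x i, y i⟩`. Such maps are automatically `B`-linear and bounded. -/
def IsAdjointable {ι : Type*} [Fintype ι] (X : (ι → E) → (ι → E)) : Prop :=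
  ∃ Y : (ι → E) → (ι → E), ∀ x y : ι → E,
    ∑ i, inner Bᵐᵒᵖ (X x i) (y i) = ∑ i, inner Bᵐᵒᵖ (x i) (Y y i)

/-- The compact endomorphisms of `E`: the closed linear span, in operator norm, of the operators
`g ↦ e ⟨f, g⟩`. -/
def compactEndomorphisms : Set (E →L[ℂ] E) :=
  closure (Submodule.span ℂ
    {T : E →L[ℂ] E | ∃ e f : E, ∀ g, T g = (inner Bᵐᵒᵖ f g : Bᵐᵒᵖ) • e} : Set (E →L[ℂ] E))

/-- `y ∈ Dom D*` and `D* y = z`. -/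
def AdjointRel (D : E →ₗ.[ℂ] E) (y z : E) : Prop :=
  ∀ x : D.domain, inner Bᵐᵒᵖ (D x) y = inner Bᵐᵒᵖ (x : E) z

/-- Regular operators: `B`-linear, densely defined and closed, with densely defined adjoint, and
such that `1 + D* D` has dense range. -/
structure IsRegular (D : E →ₗ.[ℂ] E) : Prop where
  smul_mem : ∀ (b : Bᵐᵒᵖ) (x : E), x ∈ D.domain → b • x ∈ D.domain
  map_smul : ∀ (b : Bᵐᵒᵖ) (x y : D.domain), (y : E) = b • (x : E) → D y = b • D x
  dense_domain : Dense (D.domain : Set E)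
  closed : D.IsClosed
  dense_adjoint_domain : Dense {y : E | ∃ z, AdjointRel B D y z}
  dense_range : Dense {w : E | ∃ (x : D.domain) (z : E), AdjointRel B D (D x) z ∧ w = x + z}

/-- `D` is symmetric on its domain and `Dom D* = Dom D`. -/
structure IsSelfAdjointOp (D : E →ₗ.[ℂ] E) : Prop where
  symmetric : ∀ x y : D.domain, inner Bᵐᵒᵖ (D x) (y : E) = inner Bᵐᵒᵖ (x : E) (D y)
  mem_domain : ∀ y z : E, AdjointRel B D y z → y ∈ D.domain

end Module

/-! ## The Woronowicz projection

For a selfadjoint regular operator, `1 + D²` is a bijection from `Dom D²` onto `E`. -/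

section Woronowicz

variable {E : Type*} [AddCommGroup E] [Module ℂ E]

open Classical in
/-- `D` as a function on `E`, with value `0` off the domain. -/
noncomputable def opFun (D : E →ₗ.[ℂ] E) (x : E) : E :=
  if h : x ∈ D.domain then D ⟨x, h⟩ else 0

open Classical in
/-- `(1 + D²)⁻¹`: the value at `y` is the `x ∈ Dom D²` with `x + D² x = y`. -/
noncomputable def resolventSq (D : E →ₗ.[ℂ] E) (y : E) : E :=
  if h : ∃ x : E, x ∈ D.domain ∧ opFun D x ∈ D.domain ∧ x + opFun D (opFun D x) = y
  then h.choose else 0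

/-- The Woronowicz projection, i.e. the matrix
`((1 + D²)⁻¹, D (1 + D²)⁻¹; D (1 + D²)⁻¹, D² (1 + D²)⁻¹)` acting on `M ⊕ M`, for the diagonal
operator `D` in the module `M = ⨁_{i ∈ ι} E`. -/
noncomputable def woronowicz (D : E →ₗ.[ℂ] E) (ι : Type*) (w : ι ⊕ ι → E) : ι ⊕ ι → E :=
  Sum.elim
    (fun i => resolventSq D (w (.inl i)) + opFun D (resolventSq D (w (.inr i))))
    (fun i => opFun D (resolventSq D (w (.inl i)))
      + opFun D (opFun D (resolventSq D (w (.inr i)))))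

/-- The operator `P ⊕ P` on `M ⊕ M`, for `M = ⨁_{i ∈ ι} E`. -/
def diag {ι : Type*} (P : (ι → E) → (ι → E)) (w : ι ⊕ ι → E) : ι ⊕ ι → E :=
  Sum.elim (P (w ∘ Sum.inl)) (P (w ∘ Sum.inr))

end Woronowicz

/-! ## Sobolev algebras -/

/-- `⨁_{i ∈ Idx n} E` is the direct sum of `2 ^ n` copies of `E`, built up by
`E_{n+1} = E_n ⊕ E_n`. -/
def Idx : ℕ → Type
  | 0 => Unit
  | n + 1 => Idx n ⊕ Idx n

instance instFintypeIdx : ∀ n, Fintype (Idx n)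
  | 0 => inferInstanceAs (Fintype Unit)
  | n + 1 => by
      have := instFintypeIdx n
      exact inferInstanceAs (Fintype (Idx n ⊕ Idx n))

section Sobolev

variable (B : Type*) {E : Type*} [NonUnitalCStarAlgebra B] [PartialOrder B] [StarOrderedRing B]
  [NormedAddCommGroup E] [NormedSpace ℂ E] [SMul Bᵐᵒᵖ E] [CStarModule Bᵐᵒᵖ E]

/-- `T` preserves the domain of the diagonal operator `D` in `⨁_{i ∈ ι} E`, and the graded
commutator `[D, T] = D T - T' D`, where `T'` is the image of `T` under the grading automorphism,
is the restriction of the adjointable operator `X`. -/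
def IsCommutator {ι : Type*} [Fintype ι] (D : E →ₗ.[ℂ] E) (T T' X : (ι → E) → (ι → E)) : Prop :=
  IsAdjointable B X ∧ ∀ x : ι → E, (∀ i, x i ∈ D.domain) →
    ∀ i, T x i ∈ D.domain ∧ opFun D (T x i) - T' (fun j => opFun D (x j)) i = X x i

open Classical in
/-- The adjointable extension of `[D, T]` (and `0` if there is none). -/
noncomputable def commutator {ι : Type*} [Fintype ι] (D : E →ₗ.[ℂ] E)
    (T T' : (ι → E) → (ι → E)) : (ι → E) → (ι → E) :=
  if h : ∃ X, IsCommutator B D T T' X then h.choose else 0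

/-- The matrix `(T, 0; [D, T], T')` acting on `M ⊕ M`, for `M = ⨁_{i ∈ ι} E`. -/
noncomputable def piStep {ι : Type*} [Fintype ι] (D : E →ₗ.[ℂ] E)
    (T T' : (ι → E) → (ι → E)) (w : ι ⊕ ι → E) : ι ⊕ ι → E :=
  Sum.elim (T (w ∘ Sum.inl)) (commutator B D T T' (w ∘ Sum.inl) + T' (w ∘ Sum.inr))

/-- The representations `θ_n`, on `E_n = ⨁_{i ∈ Idx n} E`, of an operator `T` on `E`. Here `ε` is
the grading operator of `E`, so that `ε T ε` is `(-1)^{∂T} T` for homogeneous `T`, and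
`π_{n+1}(T) = (θ_n(T), 0; [D, θ_n(T)], (-1)^{∂T} θ_n(T))`. With `p_{n+1}` the Woronowicz projection
on `E_n ⊕ E_n` one has `θ_1 = p_1 π_1 p_1 + p_1^⊥ π_1 p_1^⊥` and, for `n ≥ 1`,
`θ_{n+1} = p_{n+1} p_n π_{n+1} p_n p_{n+1} + p_{n+1}^⊥ p_n^⊥ π_{n+1} p_n^⊥ p_{n+1}^⊥`,
where `p_n` stands for `p_n ⊕ p_n`. -/
noncomputable def theta (ε : E → E) (D : E →ₗ.[ℂ] E) :
    (n : ℕ) → (E → E) → (Idx n → E) → (Idx n → E)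
  | 0, T => fun x i => T (x i)
  | 1, T =>
      let p : (Idx 0 ⊕ Idx 0 → E) → (Idx 0 ⊕ Idx 0 → E) := woronowicz D (Idx 0)
      let p' : (Idx 0 ⊕ Idx 0 → E) → (Idx 0 ⊕ Idx 0 → E) := fun w => w - p w
      let π := piStep B D (theta ε D 0 T) (theta ε D 0 (ε ∘ T ∘ ε))
      fun w => p (π (p w)) + p' (π (p' w))
  | n + 2, T =>
      let p : (Idx (n + 1) ⊕ Idx (n + 1) → E) → (Idx (n + 1) ⊕ Idx (n + 1) → E) :=
        woronowicz D (Idx (n + 1))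
      let p' : (Idx (n + 1) ⊕ Idx (n + 1) → E) → (Idx (n + 1) ⊕ Idx (n + 1) → E) :=
        fun w => w - p w
      let q : (Idx (n + 1) ⊕ Idx (n + 1) → E) → (Idx (n + 1) ⊕ Idx (n + 1) → E) :=
        diag (woronowicz D (Idx n))
      let q' : (Idx (n + 1) ⊕ Idx (n + 1) → E) → (Idx (n + 1) ⊕ Idx (n + 1) → E) :=
        fun w => w - q w
      let π := piStep B D (theta ε D (n + 1) T) (theta ε D (n + 1) (ε ∘ T ∘ ε))
      fun w => p (q (π (q (p w)))) + p' (q' (π (q' (p' w))))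

/-- The Sobolev condition of order `n`: `[D, θ_m(T)]` is adjointable for all `m < n`. -/
def IsSobolev (ε : E → E) (D : E →ₗ.[ℂ] E) : ℕ → (E → E) → Prop
  | 0, _ => True
  | n + 1, T => IsSobolev ε D n T ∧
      ∃ X, IsCommutator B D (theta B ε D n T) (theta B ε D n (ε ∘ T ∘ ε)) X

end Sobolev

/-! ## Unbounded `KK`-cycles -/

section Cycle

variable {A B : Type*} [NonUnitalCStarAlgebra A]
  [NonUnitalCStarAlgebra B] [PartialOrder B] [StarOrderedRing B]

/-- A graded `(A, B)`-bimodule: a graded C*-module `E` over the graded C*-algebra `B` with a graded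
*-homomorphism from `A` to the adjointable endomorphisms of `E`. -/
structure Bimodule (gA : Grading A) (gB : Grading B) (E : Type*)
    [NormedAddCommGroup E] [NormedSpace ℂ E] [CompleteSpace E] [SMul Bᵐᵒᵖ E]
    [CStarModule Bᵐᵒᵖ E] where
  /-- The grading operator of `E`. -/
  grad : E →ₗ[ℂ] E
  grad_grad : ∀ x, grad (grad x) = x
  grad_smul : ∀ (b : B) (x : E),
    grad (MulOpposite.op b • x) = MulOpposite.op (gB.aut b) • grad x
  inner_grad : ∀ x y : E, inner Bᵐᵒᵖ (grad x) (grad y) =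
    MulOpposite.op (gB.aut (MulOpposite.unop (inner Bᵐᵒᵖ x y)))
  /-- The representation of `A`. -/
  rep : A →ₙₐ[ℂ] (E →L[ℂ] E)
  inner_rep : ∀ (a : A) (x y : E), inner Bᵐᵒᵖ (rep a x) y = inner Bᵐᵒᵖ x (rep (star a) y)
  rep_aut : ∀ (a : A) (x : E), rep (gA.aut a) x = grad (rep a (grad x))

/-- The set of `a ∈ A` that satisfy the Sobolev condition of order `n` for `D`. -/
def sobolevSet {gA : Grading A} {gB : Grading B} {E : Type*}
    [NormedAddCommGroup E] [NormedSpace ℂ E] [CompleteSpace E] [SMul Bᵐᵒᵖ E]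
    [CStarModule Bᵐᵒᵖ E] (M : Bimodule gA gB E) (D : E →ₗ.[ℂ] E) (n : ℕ) : Set A :=
  {a | IsSobolev B M.grad D n (M.rep a)}

/-- Unbounded `KK`-cycles `(E, D)` for `(A, B)`. -/
structure KKCycle (gA : Grading A) (gB : Grading B) (E : Type*)
    [NormedAddCommGroup E] [NormedSpace ℂ E] [CompleteSpace E] [SMul Bᵐᵒᵖ E]
    [CStarModule Bᵐᵒᵖ E] extends Bimodule gA gB E where
  D : E →ₗ.[ℂ] E
  regular : IsRegular B D
  selfAdjoint : IsSelfAdjointOp B D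
  odd_mem : ∀ x, x ∈ D.domain → grad x ∈ D.domain
  odd : ∀ x y : D.domain, (y : E) = grad x → D y = - grad (D x)
  compact_resolvent : ∀ a : A, ∃ K ∈ compactEndomorphisms B (E := E),
    ∀ x, K x = rep a (resolventSq D x)
  dense_lipschitz : Dense (sobolevSet toBimodule D 1)

/-- The `n`-th Sobolev subalgebra `𝒜_n` of `A` (with `𝒜_0 = A`). -/
def KKCycle.sobolev {gA : Grading A} {gB : Grading B} {E : Type*}
    [NormedAddCommGroup E] [NormedSpace ℂ E] [CompleteSpace E] [SMul Bᵐᵒᵖ E]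
    [CStarModule Bᵐᵒᵖ E] (c : KKCycle gA gB E) (n : ℕ) : Set A :=
  sobolevSet c.toBimodule c.D n

/-- The cycle is (left) `C^k`. -/
def KKCycle.IsCk {gA : Grading A} {gB : Grading B} {E : Type*}
    [NormedAddCommGroup E] [NormedSpace ℂ E] [CompleteSpace E] [SMul Bᵐᵒᵖ E]
    [CStarModule Bᵐᵒᵖ E] (c : KKCycle gA gB E) (k : ℕ) : Prop :=
  Dense (c.sobolev k)

end Cycle

/-! ## Holomorphic functional calculus -/

section Holomorphic

/-- A finite family of `C¹` paths on `[0, 1]` that form a cycle: every point is as often an initial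
point as it is an end point. (Piecewise `C¹` closed curves are of this form.) -/
def IsCycle {m : ℕ} (γ : Fin m → ℝ → ℂ) : Prop :=
  (∀ j, ContDiffOn ℝ 1 (γ j) (Set.Icc 0 1)) ∧
    ∀ z : ℂ, Nat.card {j // γ j 0 = z} = Nat.card {j // γ j 1 = z}

/-- The winding number `(2πi)⁻¹ ∮ dz / (z - w)`. -/
noncomputable def windingNumber {m : ℕ} (γ : Fin m → ℝ → ℂ) (w : ℂ) : ℂ :=
  (2 * Real.pi * Complex.I)⁻¹ * ∑ j, ∫ t in (0 : ℝ)..1, deriv (γ j) t / (γ j t - w)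

/-- The cycle `γ` lies in `U \ K`, winds once around the points of `K` and does not wind around the
points outside `U`. -/
def Surrounds {m : ℕ} (γ : Fin m → ℝ → ℂ) (K U : Set ℂ) : Prop :=
  IsCycle γ ∧ (∀ j, ∀ t ∈ Set.Icc (0 : ℝ) 1, γ j t ∈ U \ K) ∧
    (∀ w ∈ K, windingNumber γ w = 1) ∧ ∀ w ∉ U, windingNumber γ w = 0

/-- `b = f(a) = (2πi)⁻¹ ∮_γ f(z) (z - a)⁻¹ dz`, for a function `f` that is holomorphic on an open
neighbourhood `U` of the spectrum of `a` and a cycle `γ` in `U` around the spectrum. -/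
def IsHolomorphicCalculus {R : Type*} [NormedRing R] [NormedAlgebra ℂ R] (a : R) (f : ℂ → ℂ)
    (b : R) : Prop :=
  ∃ U : Set ℂ, IsOpen U ∧ spectrum ℂ a ⊆ U ∧ DifferentiableOn ℂ f U ∧
    ∃ (m : ℕ) (γ : Fin m → ℝ → ℂ), Surrounds γ (spectrum ℂ a) U ∧
      b = (2 * Real.pi * Complex.I)⁻¹ •
        ∑ j, ∫ t in (0 : ℝ)..1, (f (γ j t) * deriv (γ j) t) • resolvent a (γ j t)

/-- `f(a) ∈ S` for all `a ∈ S` and all `f` holomorphic on a neighbourhood of the spectrum that `a`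
has in the unital algebra `R`. -/
def HolomorphicallyClosed {R : Type*} [NormedRing R] [NormedAlgebra ℂ R] (S : Set R) : Prop :=
  ∀ a ∈ S, ∀ (f : ℂ → ℂ) (b : R), IsHolomorphicCalculus a f b → b ∈ S

universe u

/-- `S` is a subalgebra of the C*-algebra `A` that is stable under holomorphic functional calculus
in `A`: if `A` is unital, that is, isomorphic to a unital C*-algebra `R`, then `f(a) ∈ S` for
`a ∈ S` and `f` holomorphic near the spectrum of `a` in `A`; and, whether or not `A` is unital, the
subalgebra `S⁺ = ℂ ⊕ S` of the unitization `A⁺ = ℂ ⊕ A` has the same property in `A⁺`. -/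
structure IsHolomorphicallyStable {A : Type u} [NonUnitalCStarAlgebra A] (S : Set A) : Prop where
  subalgebra : ∃ S' : NonUnitalSubalgebra ℂ A, (S' : Set A) = S
  unital : ∀ (R : Type u) [CStarAlgebra R] (ψ : A ≃⋆ₐ[ℂ] R), HolomorphicallyClosed (ψ '' S)
  unitization : HolomorphicallyClosed {b : Unitization ℂ A | b.snd ∈ S}

end Holomorphic

end KKSobolev

set_option linter.unusedSectionVars false

/-! The algebra `𝒜_n` is the domain of the map `a ↦ (π_1(a), …, π_n(a))`. The proof works with the
graph `G` of this map, and needs three properties of it.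

`G` is an algebra. The Leibniz rule for graded commutators makes the passage from `θ_n` to the
triangular matrices `π_{n+1}` multiplicative. Since `D θ_n(a) = [D, θ_n(a)] + (-1)^{∂a} θ_n(a) D`,
the matrix `π_{n+1}(a)` maps the graph of `D` into itself, so passing to the diagonal blocks for
`p_{n+1}` and its complement is multiplicative too. The factors `p_n` are harmless: `p_n` commutes
with `D` and with `θ_n(a)`, hence with `π_{n+1}(a)` (`compress_mul`, `IsLift.preserves_graph`,
`IsLift.commute`).

`G` is closed, because `D` is closed and the adjointable maps are norm closed
(`isClosed_isCommutator`).

Powers grow slowly: for every `r > ‖a‖` there is `C` with `‖π_m(a)^N‖ ≤ C r^N`. Indeed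
`π_{m+1}(a)^N` is triangular with the powers of `θ_m(a)` and of its conjugate on the diagonal, and
with a sum of `N` products off the diagonal. The factor `N` is absorbed by enlarging `r`, and
compression preserves the growth (`PowBound.triangular`, `IsTower.powBound`).

The rest is Banach algebra theory (`HasPowerGrowth.holomorphicallyClosed`). By slow growth and
closedness, `∑ c^(n+1)` converges in `G` as soon as `‖c‖` is small in `A`. Density yields an
approximate inverse in `𝒜_n` of any element of `𝒜_n` that is invertible in `A`, and the series
corrects it to the exact inverse. Resolvents lift to a continuous family in `G`, and the contour
integral stays in the closed space `G`.

If `A` is unital, its representation need not be, so `1 ∈ 𝒜_n` also needs proof. For `a ∈ 𝒜_n` near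
`1`, the small element `d = 1 - a` satisfies `d - d² = a - a² ∈ 𝒜_n`, and `d` is recovered from `d -
d²` by the Catalan power series. -/

namespace KKSobolev

/-! ### Catalan series, resolvent families and contour integrals -/

section Prelim

variable {U : Type*} [NormedRing U] [NormedAlgebra ℂ U]

theorem nonUnitalSubalgebra_pow_succ_mem {R : Type*} [Ring R] [Algebra ℂ R]
    (G : NonUnitalSubalgebra ℂ R) {x : R} (hx : x ∈ G) (n : ℕ) : x ^ (n + 1) ∈ G := by
  induction n with
  | zero => simpa using hx
  | succ n ih => rw [pow_succ]; exact mul_mem ih hx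

theorem catalan_le_four_pow (n : ℕ) : catalan n ≤ 4 ^ n :=
  calc catalan n ≤ (n + 1) * catalan n := Nat.le_mul_of_pos_left _ n.succ_pos
    _ = n.centralBinom := succ_mul_catalan_eq_centralBinom n
    _ ≤ 2 ^ (2 * n) := by rw [Nat.centralBinom_eq_two_mul_choose]; exact Nat.choose_le_two_pow _ _
    _ = 4 ^ n := by rw [pow_mul]; norm_num

theorem norm_catalan_le (n : ℕ) : ‖(catalan n : ℂ)‖ ≤ 4 ^ n := by
  rw [Complex.norm_natCast]; exact_mod_cast catalan_le_four_pow n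

/-- The generating function of the Catalan numbers solves `s = y + s²`. -/
theorem catalan_series_eq [CompleteSpace U] {y s : U} (hy : ‖y‖ < 1 / 8)
    (hs : HasSum (fun n => (catalan n : ℂ) • y ^ (n + 1)) s) : s = y + s * s ∧ ‖s‖ ≤ 1 / 4 := by
  have hgeo : HasSum (fun n : ℕ => (1 / 2 : ℝ) ^ n * (1 / 8)) (2 * (1 / 8)) :=
    hasSum_geometric_two.mul_right _
  have hle : ∀ n, ‖(catalan n : ℂ) • y ^ (n + 1)‖ ≤ (1 / 2 : ℝ) ^ n * (1 / 8) := fun n => by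
    have : (4 : ℝ) ^ n * (1 / 8) ^ (n + 1) = (1 / 2) ^ n * (1 / 8) := by
      rw [pow_succ, ← mul_assoc, ← mul_pow]; norm_num
    rw [← this, norm_smul]
    gcongr
    · exact norm_catalan_le n
    · exact (norm_pow_le' _ n.succ_pos).trans (by gcongr)
  have hsum : Summable fun n => ‖(catalan n : ℂ) • y ^ (n + 1)‖ :=
    .of_nonneg_of_le (fun _ => norm_nonneg _) hle hgeo.summable
  constructor
  · have hprod := tsum_mul_tsum_eq_tsum_sum_antidiagonal_of_summable_norm hsum hsum
    rw [hs.tsum_eq] at hprod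
    have hsucc := hs.summable.tsum_eq_zero_add
    rw [hs.tsum_eq] at hsucc
    rw [hprod]
    refine hsucc.trans ?_
    congr 1
    · simp
    · refine tsum_congr fun n => ?_
      rw [catalan_succ', Nat.cast_sum, Finset.sum_smul]
      refine Finset.sum_congr rfl fun ij hij => ?_
      rw [smul_mul_smul_comm, ← pow_add, Nat.cast_mul, ← Finset.HasAntidiagonal.mem_antidiagonal.1 hij]
      congr 2
      ring
  · calc ‖s‖ = ‖∑' n, (catalan n : ℂ) • y ^ (n + 1)‖ := by rw [hs.tsum_eq]
      _ ≤ 2 * (1 / 8) := tsum_of_norm_bounded hgeo hle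
      _ = 1 / 4 := by norm_num

theorem resolvent_sub_resolvent_eq (a : U) {z w : ℂ} (hz : z ∈ resolventSet ℂ a)
    (hw : w ∈ resolventSet ℂ a) :
    resolvent a z - resolvent a w = (w - z) • (resolvent a z * resolvent a w) := by
  have h1 : resolvent a z * (algebraMap ℂ U z - a) = 1 := Ring.inverse_mul_cancel _ hz
  have h2 : (algebraMap ℂ U w - a) * resolvent a w = 1 := Ring.mul_inverse_cancel _ hw
  calc resolvent a z - resolvent a w
      = resolvent a z * ((algebraMap ℂ U w - a) * resolvent a w)
        - (resolvent a z * (algebraMap ℂ U z - a)) * resolvent a w := by rw [h1, h2]; simp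
    _ = resolvent a z * (algebraMap ℂ U (w - z)) * resolvent a w := by
        rw [map_sub]; noncomm_ring
    _ = _ := by rw [← Algebra.commutes, mul_assoc, Algebra.smul_def]

/-- A family of elements of a normed algebra that satisfies the resolvent identity is continuous. -/
theorem continuousOn_of_resolvent_identity {v : ℂ → U} {s : Set ℂ}
    (h : ∀ z ∈ s, ∀ w ∈ s, v z - v w = (w - z) • (v z * v w)) : ContinuousOn v s := by
  intro w hw
  have hb : ∀ᶠ z in nhdsWithin w s, ‖v z‖ ≤ 2 * ‖v w‖ := by
    have hlim : Filter.Tendsto (fun z => ‖w - z‖ * ‖v w‖) (nhdsWithin w s) (nhds 0) := by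
      have : Continuous fun z => ‖w - z‖ * ‖v w‖ := by fun_prop
      simpa using (this.tendsto w).mono_left nhdsWithin_le_nhds
    filter_upwards [hlim.eventually_lt_const (by norm_num : (0 : ℝ) < 1 / 2),
      self_mem_nhdsWithin] with z hz hzs
    have h1 : ‖v z‖ ≤ ‖v w‖ + ‖w - z‖ * (‖v z‖ * ‖v w‖) :=
      calc ‖v z‖ = ‖v w + (w - z) • (v z * v w)‖ := by rw [← h z hzs w hw]; congr 1; abel
        _ ≤ ‖v w‖ + ‖w - z‖ * ‖v z * v w‖ := by rw [← norm_smul]; exact norm_add_le _ _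
        _ ≤ _ := by gcongr; exact norm_mul_le _ _
    nlinarith [norm_nonneg (v z)]
  refine tendsto_iff_norm_sub_tendsto_zero.2 ?_
  have hlim : Filter.Tendsto (fun z => ‖w - z‖ * (2 * ‖v w‖ * ‖v w‖)) (nhdsWithin w s)
      (nhds 0) := by
    have : Continuous fun z => ‖w - z‖ * (2 * ‖v w‖ * ‖v w‖) := by fun_prop
    simpa using (this.tendsto w).mono_left nhdsWithin_le_nhds
  refine squeeze_zero' (.of_forall fun _ => norm_nonneg _) ?_ hlim
  filter_upwards [hb, self_mem_nhdsWithin] with z hz hzs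
  rw [h z hzs w hw, norm_smul]
  gcongr
  exact (norm_mul_le _ _).trans (by gcongr)

theorem intervalIntegral_mem_submodule {F : Type*} [NormedAddCommGroup F] [NormedSpace ℂ F]
    [CompleteSpace F] (S : Submodule ℂ F) (hS : IsClosed (S : Set F)) {f : ℝ → F}
    (hf : ∀ t ∈ Set.Icc (0 : ℝ) 1, f t ∈ S) (hi : IntervalIntegrable f MeasureTheory.volume 0 1) :
    ∫ t in (0 : ℝ)..1, f t ∈ S := by
  rw [intervalIntegral.integral_of_le zero_le_one]
  -- The interval has length one, so the integral is an average, and averages stay in closed convex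
  -- sets.
  have : MeasureTheory.IsProbabilityMeasure
      (MeasureTheory.volume.restrict (Set.Ioc (0 : ℝ) 1)) := ⟨by simp⟩
  refine Convex.integral_mem (s := (S : Set F)) (S.restrictScalars ℝ).convex hS ?_ ?_
  · exact (MeasureTheory.ae_restrict_iff' measurableSet_Ioc).2
      (.of_forall fun t ht => hf t (Set.Ioc_subset_Icc_self ht))
  · exact (intervalIntegrable_iff_integrableOn_Ioc_of_le zero_le_one).1 hi

/-- At the ends of the interval `deriv γ` need not be the one-sided derivative of the path. This is
a null set, so the continuous function `derivWithin γ` may be used instead. -/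
theorem intervalIntegrable_mul_deriv {f : ℂ → ℂ} {γ : ℝ → ℂ} {s : Set ℂ}
    (hf : ContinuousOn f s) (hγ : ContDiffOn ℝ 1 γ (Set.Icc 0 1))
    (hs : ∀ t ∈ Set.Icc (0 : ℝ) 1, γ t ∈ s) :
    IntervalIntegrable (fun t => f (γ t) * deriv γ t) MeasureTheory.volume 0 1 := by
  have h1 : ContinuousOn (fun t => f (γ t) * derivWithin γ (Set.Icc 0 1) t) (Set.Icc 0 1) :=
    (hf.comp hγ.continuousOn hs).mul
      (hγ.continuousOn_derivWithin (uniqueDiffOn_Icc zero_lt_one) le_rfl)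
  rw [← Set.uIcc_of_le (zero_le_one (α := ℝ))] at h1
  refine h1.intervalIntegrable.congr_ae ?_
  rw [Set.uIoc_of_le zero_le_one, Filter.EventuallyEq,
    MeasureTheory.ae_restrict_iff' measurableSet_Ioc]
  have hne : ∀ᵐ t : ℝ, t ≠ 1 := by
    simp [MeasureTheory.ae_iff]
  filter_upwards [hne] with t ht1 ht
  rw [Set.uIcc_of_le zero_le_one,
    derivWithin_of_mem_nhds (Icc_mem_nhds ht.1 (lt_of_le_of_ne ht.2 ht1))]

end Prelim

/-! ### Holomorphic stability from a closed graph with slow growth of powers -/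

section Graph

variable {U V : Type*} [NormedRing U] [NormedAlgebra ℂ U] [CompleteSpace U]
  [NormedRing V] [NormedAlgebra ℂ V] [CompleteSpace V]

/-- The powers of the second component of an element `(c, v)` of `G` grow no faster than the powers
of any `r > ‖c‖`. -/
def HasPowerGrowth (G : NonUnitalSubalgebra ℂ (U × V)) : Prop :=
  ∀ c v, (c, v) ∈ G → ∀ r : ℝ, ‖c‖ < r → ∃ C : ℝ, ∀ n : ℕ, ‖v ^ n‖ ≤ C * r ^ n

variable {G : NonUnitalSubalgebra ℂ (U × V)}

/-- Growth with `r = 1/8` against coefficients of size `4 ^ n` leaves the ratio `1/2` in both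
components, so the series converges in the product, and its limit lies in the closed set `G`. There
is no constant term because `G` is not known to contain a unit. -/
theorem HasPowerGrowth.hasSum_mem (hgr : HasPowerGrowth G) (hcl : IsClosed (G : Set (U × V)))
    {c : U} (hc : c ∈ Prod.fst '' (G : Set (U × V))) (hn : ‖c‖ < 1 / 8) (k : ℕ → ℂ)
    (hk : ∀ n, ‖k n‖ ≤ 4 ^ n) :
    ∃ s ∈ Prod.fst '' (G : Set (U × V)), HasSum (fun n => k n • c ^ (n + 1)) s := by
  obtain ⟨⟨c', v⟩, hG, rfl⟩ := hc
  obtain ⟨C, hC⟩ := hgr _ _ hG _ hn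
  have hgeo : Summable fun n : ℕ => (1 / 2 : ℝ) ^ n :=
    summable_geometric_of_lt_one (by norm_num) (by norm_num)
  have h4 : ∀ n : ℕ, (4 : ℝ) ^ n * (1 / 8) ^ (n + 1) = (1 / 2) ^ n * (1 / 8) := fun n => by
    rw [pow_succ, ← mul_assoc, ← mul_pow]; norm_num
  have h1 : Summable fun n => k n • c' ^ (n + 1) := by
    refine .of_norm_bounded (hgeo.mul_right (1 / 8)) fun n => ?_
    rw [← h4, norm_smul]
    gcongr
    · exact hk n
    · exact (norm_pow_le' _ n.succ_pos).trans (by gcongr)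
  have h2 : Summable fun n => k n • v ^ (n + 1) := by
    refine .of_norm_bounded (hgeo.mul_right (C * (1 / 8))) fun n => ?_
    calc ‖k n • v ^ (n + 1)‖ ≤ 4 ^ n * (C * (1 / 8) ^ (n + 1)) := by
          rw [norm_smul]
          exact mul_le_mul (hk n) (hC _) (norm_nonneg _) (by positivity)
      _ = _ := by rw [mul_left_comm, h4]; ring
  refine ⟨_, ⟨(_, ∑' n, k n • v ^ (n + 1)), ?_, rfl⟩, h1.hasSum⟩
  have hs : HasSum (fun n => k n • (c', v) ^ (n + 1))
      (∑' n, k n • c' ^ (n + 1), ∑' n, k n • v ^ (n + 1)) := h1.hasSum.prodMk h2.hasSum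
  exact hcl.mem_of_tendsto hs <| .of_forall fun s =>
    sum_mem fun n _ => SMulMemClass.smul_mem _ (nonUnitalSubalgebra_pow_succ_mem G hG n)

/-- For `a` in the projection of `G` near `1`, the element `d = 1 - a` is a small root of `s = y +
s²` with `y = d - d² = a - a²`, and `y` lies in the projection. The Catalan series is another small
root, and it lies there too. Small roots are unique, so `1 = a + d` lies there. -/
theorem HasPowerGrowth.one_mem (hgr : HasPowerGrowth G) (hcl : IsClosed (G : Set (U × V)))
    (hd : Dense (Prod.fst '' (G : Set (U × V)))) : (1 : U) ∈ Prod.fst '' (G : Set (U × V)) := by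
  obtain ⟨a, ha, ha1⟩ := hd.exists_dist_lt (1 : U) (by norm_num : (0 : ℝ) < 1 / 16)
  rw [dist_eq_norm] at ha1
  set d : U := 1 - a with hdef
  have hy : ‖d - d * d‖ < 1 / 8 := by
    have h1 := norm_sub_le d (d * d)
    have h2 := norm_mul_le d d
    nlinarith [norm_nonneg d]
  have hyS : d - d * d ∈ Prod.fst '' (G : Set (U × V)) := by
    obtain ⟨p, hp, rfl⟩ := ha
    refine ⟨p - p * p, sub_mem hp (mul_mem hp hp), ?_⟩
    simp only [hdef, Prod.fst_sub, Prod.fst_mul]; noncomm_ring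
  obtain ⟨s, hsS, hs⟩ := hgr.hasSum_mem hcl hyS hy _ norm_catalan_le
  obtain ⟨hs1, hs2⟩ := catalan_series_eq hy hs
  have hsd : s = d := by
    -- The difference of the two quadratic equations; as `‖s‖ + ‖d‖ < 1`, it forces `s = d`.
    have key : s - d = s * (s - d) + (s - d) * d := by
      nth_rewrite 1 [hs1]; noncomm_ring
    have h1 := norm_add_le (s * (s - d)) ((s - d) * d)
    rw [← key] at h1
    have h2 := norm_mul_le s (s - d)
    have h3 := norm_mul_le (s - d) d
    have h0 : ‖s - d‖ = 0 := by nlinarith [norm_nonneg (s - d), norm_nonneg d, norm_nonneg s]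
    exact sub_eq_zero.1 (norm_eq_zero.1 h0)
  obtain ⟨p, hp, rfl⟩ := ha
  obtain ⟨p', hp', rfl⟩ := hsS
  exact ⟨p + p', add_mem hp hp', by rw [Prod.fst_add, hsd, hdef]; abel⟩

/-- Density provides `b` so close to `u` that `c = 1 - a b = a (u - b)` is small. Then `(a b)⁻¹ = 1
+ ∑ c^(n+1)`, and `u = b (a b)⁻¹`. -/
theorem HasPowerGrowth.inv_mem (hgr : HasPowerGrowth G) (hcl : IsClosed (G : Set (U × V)))
    (hd : Dense (Prod.fst '' (G : Set (U × V)))) {a u : U}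
    (ha : a ∈ Prod.fst '' (G : Set (U × V))) (hau : a * u = 1) (hua : u * a = 1) :
    u ∈ Prod.fst '' (G : Set (U × V)) := by
  obtain ⟨b, hb, hb1⟩ := hd.exists_dist_lt u
    (by positivity : (0 : ℝ) < 1 / 8 / (‖a‖ + 1))
  rw [dist_eq_norm] at hb1
  set c : U := 1 - a * b with hdef
  have hc : ‖c‖ < 1 / 8 := by
    rw [lt_div_iff₀ (by positivity)] at hb1
    have h1 : c = a * (u - b) := by rw [hdef, mul_sub, hau]
    have h2 := norm_mul_le a (u - b)
    rw [h1]; nlinarith [norm_nonneg (u - b)]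
  have h1S := hgr.one_mem hcl hd
  obtain ⟨p, hp, rfl⟩ := ha
  obtain ⟨p', hp', rfl⟩ := hb
  obtain ⟨e, he, he1⟩ := h1S
  obtain ⟨s, ⟨q, hq, rfl⟩, hs⟩ := hgr.hasSum_mem hcl
    (⟨e - p * p', sub_mem he (mul_mem hp hp'), by simp [he1, hdef]⟩) hc (fun _ => 1)
    (fun n => by simpa using one_le_pow₀ (by norm_num : (1 : ℝ) ≤ 4))
  have hinv : p.1 * p'.1 * (1 + q.1) = 1 := by
    have h1 : (1 - c) * ∑' n, c ^ n = 1 := mul_neg_geom_series c (hc.trans (by norm_num))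
    have h2 : Summable fun n => c ^ n :=
      summable_geometric_of_norm_lt_one (hc.trans (by norm_num))
    rw [h2.tsum_eq_zero_add, pow_zero] at h1
    simp only [one_smul] at hs
    rw [hs.tsum_eq, hdef, sub_sub_cancel] at h1
    exact h1
  refine ⟨p' * (e + q), mul_mem hp' (add_mem he hq), ?_⟩
  calc p'.1 * (e.1 + q.1) = u * p.1 * (p'.1 * (e.1 + q.1)) := by rw [hua, one_mul]
    _ = u * (p.1 * p'.1 * (1 + q.1)) := by rw [he1]; simp only [mul_assoc]
    _ = u := by rw [hinv, mul_one]

/-- A dense subalgebra of a Banach algebra that is the projection of a closed subalgebra `G` of a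
product, with slow growth of powers in the second component, is stable under holomorphic functional
calculus. -/
theorem HasPowerGrowth.holomorphicallyClosed (hgr : HasPowerGrowth G)
    (hcl : IsClosed (G : Set (U × V))) (hinj : ∀ v, (0, v) ∈ G → v = 0)
    (hd : Dense (Prod.fst '' (G : Set (U × V)))) :
    HolomorphicallyClosed (Prod.fst '' (G : Set (U × V))) := by
  rintro a ha f b ⟨O, -, -, hf, m, γ, ⟨⟨hγ, -⟩, hmem, -⟩, rfl⟩
  have hres : ∀ z ∈ resolventSet ℂ a, ∃ v, (resolvent a z, v) ∈ G := fun z hz => by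
    obtain ⟨e, he, he1⟩ := hgr.one_mem hcl hd
    obtain ⟨p, hp, rfl⟩ := ha
    obtain ⟨q, hq, hq1⟩ := hgr.inv_mem hcl hd (a := algebraMap ℂ U z - p.1)
      ⟨z • e - p, sub_mem (SMulMemClass.smul_mem _ he) hp, by
        simp [he1, Algebra.algebraMap_eq_smul_one]⟩
      (Ring.mul_inverse_cancel _ hz) (Ring.inverse_mul_cancel _ hz)
    exact ⟨q.2, by rw [resolvent, ← hq1]; exact hq⟩
  choose! v hv using hres
  -- The second component is determined by the first, so the resolvent identity passes to `v`.
  -- Continuity of `v`, hence of the lifted integrand, follows.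
  have hid : ∀ z ∈ resolventSet ℂ a, ∀ w ∈ resolventSet ℂ a,
      v z - v w = (w - z) • (v z * v w) := fun z hz w hw => by
    have h1 := sub_mem (sub_mem (hv z hz) (hv w hw))
      (SMulMemClass.smul_mem (w - z) (mul_mem (hv z hz) (hv w hw)))
    refine sub_eq_zero.1 (hinj _ ?_)
    convert h1 using 1
    ext
    · simp [resolvent_sub_resolvent_eq a hz hw]
    · simp
  have hcont : ContinuousOn (fun z => (resolvent a z, v z)) (resolventSet ℂ a) :=
    (continuousOn_of_resolvent_identity fun z hz w hw =>
      resolvent_sub_resolvent_eq a hz hw).prodMk (continuousOn_of_resolvent_identity hid)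
  have hρ : ∀ j, ∀ t ∈ Set.Icc (0 : ℝ) 1, γ j t ∈ resolventSet ℂ a := fun j t ht => by
    simpa [spectrum] using (hmem j t ht).2
  have hint : ∀ j, IntervalIntegrable
      (fun t => (f (γ j t) * deriv (γ j) t) • (resolvent a (γ j t), v (γ j t)))
      MeasureTheory.volume 0 1 := fun j => by
    refine (intervalIntegrable_mul_deriv hf.continuousOn (hγ j)
      fun t ht => (hmem j t ht).1).smul_continuousOn ?_
    rw [Set.uIcc_of_le zero_le_one]
    exact hcont.comp (hγ j).continuousOn (hρ j)
  refine ⟨(2 * Real.pi * Complex.I)⁻¹ • ∑ j, ∫ t in (0 : ℝ)..1,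
    (f (γ j t) * deriv (γ j) t) • (resolvent a (γ j t), v (γ j t)), ?_, ?_⟩
  · refine SMulMemClass.smul_mem _ (sum_mem fun j _ => ?_)
    exact intervalIntegral_mem_submodule G.toSubmodule hcl
      (fun t ht => SMulMemClass.smul_mem _ (hv _ (hρ j t ht))) (hint j)
  · rw [Prod.smul_fst, Prod.fst_sum]
    congr 1
    refine Finset.sum_congr rfl fun j _ => ?_
    exact ((ContinuousLinearMap.fst ℂ U V).intervalIntegral_comp_comm (hint j)).symm

end Graph


/-! ### Adjointable maps on finite sums of a C*-module -/

section ModuleBasics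

/-- Reversing the product exchanges `t* t` and `t t*`, and both describe the same positive cone. -/
instance instStarOrderedRingMulOpposite {B : Type*} [NonUnitalCStarAlgebra B] [PartialOrder B]
    [StarOrderedRing B] : StarOrderedRing Bᵐᵒᵖ := by
  refine StarOrderedRing.of_nonneg_iff' (fun {x y} h z => ?_) fun x => ?_
  · exact add_le_add_right (α := B) h (MulOpposite.unop z)
  · have h1 : (0 ≤ x) ↔ (0 ≤ MulOpposite.unop x) := Iff.rfl
    rw [h1]
    constructor
    · intro h
      obtain ⟨t, ht⟩ := CStarAlgebra.nonneg_iff_eq_star_mul_self.1 h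
      exact ⟨MulOpposite.op (star t), MulOpposite.unop_injective (by simpa using ht)⟩
    · rintro ⟨s, rfl⟩
      exact mul_star_self_nonneg (MulOpposite.unop s)

variable {B E : Type*} [NonUnitalCStarAlgebra B] [PartialOrder B] [StarOrderedRing B]
  [NormedAddCommGroup E] [NormedSpace ℂ E] [SMul Bᵐᵒᵖ E] [CStarModule Bᵐᵒᵖ E]

variable (B) in
theorem continuous_inner_left (y : E) : Continuous fun x : E => inner Bᵐᵒᵖ x y :=
  (CStarModule.continuous_inner (A := Bᵐᵒᵖ)).comp (continuous_id.prodMk continuous_const)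

variable (B) in
theorem continuous_inner_right (x : E) : Continuous fun y : E => inner Bᵐᵒᵖ x y :=
  (CStarModule.continuous_inner (A := Bᵐᵒᵖ)).comp (continuous_const.prodMk continuous_id)

variable (B) in
theorem eq_of_forall_inner_left {y z : E} (h : ∀ x : E, inner Bᵐᵒᵖ x y = inner Bᵐᵒᵖ x z) :
    y = z := by
  rw [← sub_eq_zero, ← CStarModule.inner_self (A := Bᵐᵒᵖ), CStarModule.inner_sub_right, h, sub_self]

variable (B) in
-- `ι → E` carries the supremum norm, not the norm of the C*-module. This bound and
-- `norm_sum_inner_le` compare the two up to constants, which do not affect limits or rates of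
-- growth.
theorem norm_sq_le_norm_sum_inner {ι : Type*} [Fintype ι] (x : ι → E) :
    ‖x‖ ^ 2 ≤ ‖∑ i, inner Bᵐᵒᵖ (x i) (x i)‖ := by
  have h : ∀ i, ‖x i‖ ≤ √‖∑ i, inner Bᵐᵒᵖ (x i) (x i)‖ := fun i => by
    rw [CStarModule.norm_eq_sqrt_norm_inner_self (A := Bᵐᵒᵖ)]
    exact Real.sqrt_le_sqrt (CStarAlgebra.norm_le_norm_of_nonneg_of_le CStarModule.inner_self_nonneg
      (Finset.single_le_sum (f := fun i => inner Bᵐᵒᵖ (x i) (x i))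
        (fun i _ => CStarModule.inner_self_nonneg) (Finset.mem_univ i)))
  calc ‖x‖ ^ 2 ≤ √‖∑ i, inner Bᵐᵒᵖ (x i) (x i)‖ ^ 2 := by
        gcongr; exact (pi_norm_le_iff_of_nonneg (Real.sqrt_nonneg _)).2 h
    _ = _ := Real.sq_sqrt (norm_nonneg _)

variable (B) in
theorem norm_sum_inner_le {ι : Type*} [Fintype ι] (x y : ι → E) :
    ‖∑ i, inner Bᵐᵒᵖ (x i) (y i)‖ ≤ Fintype.card ι * (‖x‖ * ‖y‖) :=
  calc ‖∑ i, inner Bᵐᵒᵖ (x i) (y i)‖ ≤ ∑ i, ‖inner Bᵐᵒᵖ (x i) (y i)‖ := norm_sum_le _ _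
    _ ≤ ∑ _i : ι, ‖x‖ * ‖y‖ := Finset.sum_le_sum fun i _ =>
        (CStarModule.norm_inner_le E).trans (mul_le_mul (norm_le_pi_norm x i) (norm_le_pi_norm y i)
          (norm_nonneg _) (norm_nonneg _))
    _ = _ := by simp

variable (B) in
theorem eq_of_forall_sum_inner {ι : Type*} [Fintype ι] {y z : ι → E}
    (h : ∀ x : ι → E, ∑ i, inner Bᵐᵒᵖ (y i) (x i) = ∑ i, inner Bᵐᵒᵖ (z i) (x i)) : y = z := by
  have h1 := norm_sq_le_norm_sum_inner B (y - z)
  have h0 : ∑ i, inner Bᵐᵒᵖ ((y - z) i) ((y - z) i) = 0 := by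
    have := h (y - z)
    rw [← sub_eq_zero, ← Finset.sum_sub_distrib] at this
    simpa only [Pi.sub_apply, CStarModule.inner_sub_left] using this
  rw [h0, norm_zero] at h1
  have h2 : ‖y - z‖ = 0 := by nlinarith [norm_nonneg (y - z)]
  exact sub_eq_zero.1 (norm_eq_zero.1 h2)

variable (B) in
theorem continuous_sum_inner_left {ι : Type*} [Fintype ι] (y : ι → E) :
    Continuous fun x : ι → E => ∑ i, inner Bᵐᵒᵖ (x i) (y i) :=
  continuous_finsetSum _ fun i _ => (continuous_inner_left B (y i)).comp (continuous_apply i)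

variable (B) in
theorem continuous_sum_inner_right {ι : Type*} [Fintype ι] (x : ι → E) :
    Continuous fun y : ι → E => ∑ i, inner Bᵐᵒᵖ (x i) (y i) :=
  continuous_finsetSum _ fun i _ => (continuous_inner_right B (x i)).comp (continuous_apply i)

section Adjointable

variable {ι : Type*} [Fintype ι]

/-- Linearity follows from nondegeneracy of the inner product, boundedness from the closed graph
theorem. -/
theorem IsAdjointable.exists_clm [CompleteSpace E] {X : (ι → E) → (ι → E)}
    (hX : IsAdjointable B X) : ∃ X' : (ι → E) →L[ℂ] (ι → E), ⇑X' = X := by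
  obtain ⟨Y, hY⟩ := hX
  let L : (ι → E) →ₗ[ℂ] (ι → E) :=
    { toFun := X
      map_add' := fun x y => eq_of_forall_sum_inner B fun z => by
        rw [hY]
        simp only [Pi.add_apply, CStarModule.inner_add_left, Finset.sum_add_distrib, hY]
      map_smul' := fun c x => eq_of_forall_sum_inner B fun z => by
        rw [hY]
        simp only [Pi.smul_apply, CStarModule.inner_smul_left_complex, ← Finset.smul_sum, hY,
          RingHom.id_apply] }
  have hL : Continuous L := by
    refine L.continuous_of_seq_closed_graph fun u x y hu hy => ?_
    refine eq_of_forall_sum_inner B fun z => ?_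
    have h1 := ((continuous_sum_inner_left B z).tendsto y).comp hy
    have h2 := ((continuous_sum_inner_left B (Y z)).tendsto x).comp hu
    refine (tendsto_nhds_unique h1 ?_).trans (hY x z).symm
    exact h2.congr fun n => (hY (u n) z).symm
  exact ⟨⟨L, hL⟩, rfl⟩

theorem IsAdjointable.add {X X' : (ι → E) → (ι → E)} (hX : IsAdjointable B X)
    (hX' : IsAdjointable B X') : IsAdjointable B (X + X') := by
  obtain ⟨Y, hY⟩ := hX
  obtain ⟨Y', hY'⟩ := hX'
  refine ⟨Y + Y', fun x y => ?_⟩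
  simp only [Pi.add_apply, CStarModule.inner_add_left, CStarModule.inner_add_right,
    Finset.sum_add_distrib, hY, hY']

theorem IsAdjointable.smul {X : (ι → E) → (ι → E)} (hX : IsAdjointable B X) (c : ℂ) :
    IsAdjointable B (c • X) := by
  obtain ⟨Y, hY⟩ := hX
  refine ⟨star c • Y, fun x y => ?_⟩
  simp only [Pi.smul_apply, CStarModule.inner_smul_left_complex,
    CStarModule.inner_smul_right_complex, ← Finset.smul_sum, hY]

theorem IsAdjointable.comp {X X' : (ι → E) → (ι → E)} (hX : IsAdjointable B X)
    (hX' : IsAdjointable B X') : IsAdjointable B (X ∘ X') := by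
  obtain ⟨Y, hY⟩ := hX
  obtain ⟨Y', hY'⟩ := hX'
  exact ⟨Y' ∘ Y, fun x y => by simp only [Function.comp_apply, hY, hY']⟩

variable (B) in
-- Taking adjoints is Lipschitz for these norms, so the adjoints of a convergent sequence converge
-- pointwise, and the limit is an adjoint of the limit operator.
theorem isClosed_isAdjointable [CompleteSpace E] :
    IsClosed {X : (ι → E) →L[ℂ] (ι → E) | IsAdjointable B X} := by
  refine IsSeqClosed.isClosed fun X X₀ hX hlim => ?_
  choose Y hY using hX
  have hbound : ∀ k l y, ‖Y k y - Y l y‖ ≤ Fintype.card ι * (‖X k - X l‖ * ‖y‖) := by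
    intro k l y
    set z := Y k y - Y l y with hz
    have h1 : ∑ i, inner Bᵐᵒᵖ (z i) (z i) = ∑ i, inner Bᵐᵒᵖ ((X k - X l) z i) (y i) := by
      simp only [sub_apply, Pi.sub_apply, CStarModule.inner_sub_left, Finset.sum_sub_distrib, hY]
      rw [← Finset.sum_sub_distrib]
      exact Finset.sum_congr rfl fun i _ => by rw [← CStarModule.inner_sub_right]; rfl
    have h2 := norm_sq_le_norm_sum_inner B z
    rw [h1] at h2
    have h3 := h2.trans (norm_sum_inner_le B ((X k - X l) z) y)
    have h4 := (X k - X l).le_opNorm z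
    rcases (norm_nonneg z).eq_or_lt with h0 | h0
    · rw [← h0]; positivity
    · have h5 : ‖z‖ * ‖z‖ ≤ ‖z‖ * (Fintype.card ι * (‖X k - X l‖ * ‖y‖)) :=
        calc ‖z‖ * ‖z‖ = ‖z‖ ^ 2 := (sq _).symm
          _ ≤ Fintype.card ι * (‖X k - X l‖ * ‖z‖ * ‖y‖) := h3.trans (by gcongr)
          _ = _ := by ring
      exact le_of_mul_le_mul_left h5 h0
  have hcauchy : ∀ y, CauchySeq fun k => Y k y := fun y => by
    have hX := hlim.cauchySeq
    rw [Metric.cauchySeq_iff] at hX ⊢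
    intro ε hε
    obtain ⟨N, hN⟩ := hX (ε / (Fintype.card ι * ‖y‖ + 1)) (by positivity)
    refine ⟨N, fun m hm n hn => ?_⟩
    have h1 := hN m hm n hn
    rw [dist_eq_norm, lt_div_iff₀ (by positivity)] at h1
    rw [dist_eq_norm]
    calc _ ≤ _ := hbound m n y
      _ ≤ ‖X m - X n‖ * (Fintype.card ι * ‖y‖ + 1) := by
        nlinarith [norm_nonneg (X m - X n)]
      _ < ε := h1
  choose Y₀ hY₀ using fun y => cauchySeq_tendsto_of_complete (hcauchy y)
  refine ⟨Y₀, fun x y => ?_⟩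
  have h1 : Filter.Tendsto (fun k => X k x) Filter.atTop (nhds (X₀ x)) :=
    ((ContinuousLinearMap.apply ℂ (ι → E) x).continuous.tendsto X₀).comp hlim
  have h2 := ((continuous_sum_inner_left B y).tendsto _).comp h1
  have h3 := ((continuous_sum_inner_right B x).tendsto _).comp (hY₀ y)
  exact tendsto_nhds_unique h2 (h3.congr fun k => (hY k x y).symm)

end Adjointable

/-! The resolvent `(1 + D²)⁻¹`. -/

section Resolvent

variable {D : E →ₗ.[ℂ] E}

theorem opFun_of_mem {x : E} (hx : x ∈ D.domain) : opFun D x = D ⟨x, hx⟩ := by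
  rw [opFun, dif_pos hx]

theorem opFun_add {x y : E} (hx : x ∈ D.domain) (hy : y ∈ D.domain) :
    opFun D (x + y) = opFun D x + opFun D y := by
  rw [opFun_of_mem hx, opFun_of_mem hy, opFun_of_mem (add_mem hx hy), ← D.map_add]; rfl

theorem opFun_sub {x y : E} (hx : x ∈ D.domain) (hy : y ∈ D.domain) :
    opFun D (x - y) = opFun D x - opFun D y := by
  rw [opFun_of_mem hx, opFun_of_mem hy, opFun_of_mem (sub_mem hx hy), ← D.map_sub]; rfl

theorem opFun_smul {x : E} (c : ℂ) (hx : x ∈ D.domain) :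
    opFun D (c • x) = c • opFun D x := by
  rw [opFun_of_mem hx, opFun_of_mem (D.domain.smul_mem c hx), ← D.map_smul]; rfl

theorem opFun_zero : opFun D 0 = 0 := by
  rw [opFun_of_mem D.domain.zero_mem]; exact D.map_zero

theorem mem_graph_iff_opFun {x y : E} : (x, y) ∈ D.graph ↔ x ∈ D.domain ∧ opFun D x = y := by
  rw [LinearPMap.mem_graph_iff]
  constructor
  · rintro ⟨z, rfl, hz⟩
    exact ⟨z.2, by rw [opFun_of_mem z.2]; exact hz⟩
  · rintro ⟨hx, hy⟩
    exact ⟨⟨x, hx⟩, rfl, by rw [← opFun_of_mem hx]; exact hy⟩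

theorem mem_graph_opFun {x : E} (hx : x ∈ D.domain) : (x, opFun D x) ∈ D.graph :=
  mem_graph_iff_opFun.2 ⟨hx, rfl⟩

variable (hS : IsSelfAdjointOp B D)
include hS

theorem IsSelfAdjointOp.inner_opFun {x y : E} (hx : x ∈ D.domain) (hy : y ∈ D.domain) :
    inner Bᵐᵒᵖ (opFun D x) y = inner Bᵐᵒᵖ x (opFun D y) := by
  rw [opFun_of_mem hx, opFun_of_mem hy]; exact hS.symmetric ⟨x, hx⟩ ⟨y, hy⟩

theorem IsSelfAdjointOp.eq_opFun_of_adjointRel (hd : Dense (D.domain : Set E)) {y z : E}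
    (h : AdjointRel B D y z) : y ∈ D.domain ∧ opFun D y = z := by
  have hy := hS.mem_domain y z h
  refine ⟨hy, eq_of_forall_inner_left B fun x => ?_⟩
  refine congrFun (Continuous.ext_on hd (continuous_inner_left B (opFun D y))
    (continuous_inner_left B z) fun x hx => ?_) x
  have h1 : inner Bᵐᵒᵖ x (opFun D y) = inner Bᵐᵒᵖ (opFun D x) y := (hS.inner_opFun hx hy).symm
  exact h1.trans (by rw [opFun_of_mem hx]; exact h ⟨x, hx⟩)

/-- `1 + D²` is bounded below, together with `D`. -/
theorem IsSelfAdjointOp.norm_le {x : E} (hx : x ∈ D.domain) (hDx : opFun D x ∈ D.domain) :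
    ‖x‖ ≤ ‖x + opFun D (opFun D x)‖ ∧ ‖opFun D x‖ ≤ ‖x + opFun D (opFun D x)‖ := by
  set y := x + opFun D (opFun D x) with hy
  -- Both summands are positive, so each is dominated in norm by the left side.
  have h1 : inner Bᵐᵒᵖ x y = inner Bᵐᵒᵖ x x + inner Bᵐᵒᵖ (opFun D x) (opFun D x) := by
    rw [hy, CStarModule.inner_add_right, hS.inner_opFun hx hDx]
  have h2 : ‖inner Bᵐᵒᵖ x y‖ ≤ ‖x‖ * ‖y‖ := CStarModule.norm_inner_le E
  have hnn : ∀ z : E, (0 : Bᵐᵒᵖ) ≤ inner Bᵐᵒᵖ z z := fun z => CStarModule.inner_self_nonneg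
  have h3 : ‖x‖ ^ 2 ≤ ‖x‖ * ‖y‖ := by
    rw [CStarModule.norm_sq_eq Bᵐᵒᵖ]
    refine (CStarAlgebra.norm_le_norm_of_nonneg_of_le (hnn x) ?_).trans h2
    rw [h1]; exact le_add_of_nonneg_right (hnn _)
  have h4 : ‖opFun D x‖ ^ 2 ≤ ‖x‖ * ‖y‖ := by
    rw [CStarModule.norm_sq_eq Bᵐᵒᵖ]
    refine (CStarAlgebra.norm_le_norm_of_nonneg_of_le (hnn _) ?_).trans h2
    rw [h1]; exact le_add_of_nonneg_left (hnn _)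
  have h5 : ‖x‖ ≤ ‖y‖ := by
    rcases (norm_nonneg x).eq_or_lt with h0 | h0
    · rw [← h0]; exact norm_nonneg _
    · nlinarith
  exact ⟨h5, abs_le_of_sq_le_sq' (by nlinarith [norm_nonneg y]) (norm_nonneg y) |>.2⟩

/-- `1 + D²` has dense range by regularity. If `x_n + D² x_n → y`, the lower bounds of `norm_le`
make `x_n` and `D x_n` Cauchy, and closedness of `D`, used twice, identifies the limits. -/
theorem IsSelfAdjointOp.exists_resolventSq [CompleteSpace E] (hD : IsRegular B D) (y : E) :
    ∃ x : E, x ∈ D.domain ∧ opFun D x ∈ D.domain ∧ x + opFun D (opFun D x) = y := by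
  obtain ⟨w, hw, hlim⟩ := mem_closure_iff_seq_limit.1 (hD.dense_range y)
  choose x z hz hwz using hw
  have hDx : ∀ n, opFun D (x n) ∈ D.domain ∧ opFun D (opFun D (x n)) = z n := fun n => by
    have := hS.eq_opFun_of_adjointRel hD.dense_domain (hz n)
    rwa [opFun_of_mem (x n).2]
  have hw' : ∀ n, w n = x n + opFun D (opFun D (x n)) := fun n => by rw [(hDx n).2]; exact hwz n
  have hbd : ∀ m n, ‖(x m : E) - x n‖ ≤ ‖w m - w n‖ ∧
      ‖opFun D (x m) - opFun D (x n)‖ ≤ ‖w m - w n‖ := fun m n => by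
    have := hS.norm_le (sub_mem (x m).2 (x n).2)
      (by rw [opFun_sub (x m).2 (x n).2]; exact sub_mem (hDx m).1 (hDx n).1)
    rw [opFun_sub (x m).2 (x n).2, opFun_sub (hDx m).1 (hDx n).1] at this
    rwa [hw' m, hw' n, add_sub_add_comm]
  have hcw := hlim.cauchySeq
  have hcx : CauchySeq fun n => (x n : E) := by
    rw [Metric.cauchySeq_iff] at hcw ⊢
    intro ε hε
    obtain ⟨N, hN⟩ := hcw ε hε
    refine ⟨N, fun m hm n hn => lt_of_le_of_lt ?_ (hN m hm n hn)⟩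
    rw [dist_eq_norm, dist_eq_norm]; exact (hbd m n).1
  have hcD : CauchySeq fun n => opFun D (x n) := by
    rw [Metric.cauchySeq_iff] at hcw ⊢
    intro ε hε
    obtain ⟨N, hN⟩ := hcw ε hε
    refine ⟨N, fun m hm n hn => lt_of_le_of_lt ?_ (hN m hm n hn)⟩
    rw [dist_eq_norm, dist_eq_norm]; exact (hbd m n).2
  obtain ⟨x₀, hx₀⟩ := cauchySeq_tendsto_of_complete hcx
  obtain ⟨v₀, hv₀⟩ := cauchySeq_tendsto_of_complete hcD
  have hg : IsClosed (D.graph : Set (E × E)) := hD.closed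
  have h1 : (x₀, v₀) ∈ D.graph := hg.mem_of_tendsto (hx₀.prodMk_nhds hv₀)
    (.of_forall fun n => mem_graph_opFun (x n).2)
  have h2 : (v₀, y - x₀) ∈ D.graph := by
    refine hg.mem_of_tendsto (hv₀.prodMk_nhds (hlim.sub hx₀)) (.of_forall fun n => ?_)
    have : w n - x n = opFun D (opFun D (x n)) := by rw [hw' n, add_sub_cancel_left]
    simp only [this]
    exact mem_graph_opFun (hDx n).1
  rw [mem_graph_iff_opFun] at h1 h2
  rw [← h1.2] at h2
  exact ⟨x₀, h1.1, h2.1, by rw [h2.2]; abel⟩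

theorem IsSelfAdjointOp.resolventSq_unique {x y : E} (hx : x ∈ D.domain)
    (hDx : opFun D x ∈ D.domain) (h : x + opFun D (opFun D x) = y) : resolventSq D y = x := by
  have hex : ∃ x : E, x ∈ D.domain ∧ opFun D x ∈ D.domain ∧ x + opFun D (opFun D x) = y :=
    ⟨x, hx, hDx, h⟩
  rw [resolventSq, dif_pos hex]
  obtain ⟨h1, h2, h3⟩ := hex.choose_spec
  have := (hS.norm_le (sub_mem h1 hx) (by rw [opFun_sub h1 hx]; exact sub_mem h2 hDx)).1
  rw [opFun_sub h1 hx, opFun_sub h2 hDx, ← add_sub_add_comm, h3, h, sub_self, norm_zero] at this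
  exact sub_eq_zero.1 (norm_le_zero_iff.1 this)

end Resolvent

end ModuleBasics


/-- The bounded operators on `⨁_{i ∈ ι} E`. -/
abbrev EndPi (ι E : Type*) [NormedAddCommGroup E] [NormedSpace ℂ E] :=
  (ι → E) →L[ℂ] (ι → E)

/-! ### Lower triangular matrices of operators -/

section Block

variable {ι E : Type*} [NormedAddCommGroup E] [NormedSpace ℂ E]

/-- The first inclusion `M → M ⊕ M`, for `M = ⨁_{i ∈ ι} E`. -/
def blockInl : (ι → E) →L[ℂ] (ι ⊕ ι → E) := .pi (Sum.elim (fun k => .proj k) 0)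

/-- The second inclusion `M → M ⊕ M`, for `M = ⨁_{i ∈ ι} E`. -/
def blockInr : (ι → E) →L[ℂ] (ι ⊕ ι → E) := .pi (Sum.elim 0 (fun k => .proj k))

/-- The first projection `M ⊕ M → M`, for `M = ⨁_{i ∈ ι} E`. -/
def blockFst : (ι ⊕ ι → E) →L[ℂ] (ι → E) := .pi fun k => .proj (Sum.inl k)

/-- The second projection `M ⊕ M → M`, for `M = ⨁_{i ∈ ι} E`. -/
def blockSnd : (ι ⊕ ι → E) →L[ℂ] (ι → E) := .pi fun k => .proj (Sum.inr k)

/-- The matrix `(T, 0; X, S)` of operators on `M = ⨁_{i ∈ ι} E`. -/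
def tri (T X S : EndPi ι E) : EndPi (ι ⊕ ι) E :=
  blockInl ∘L T ∘L blockFst + blockInr ∘L X ∘L blockFst + blockInr ∘L S ∘L blockSnd

@[simp] theorem tri_inl (T X S : EndPi ι E) (w : ι ⊕ ι → E) (i : ι) :
    tri T X S w (Sum.inl i) = T (w ∘ Sum.inl) i := by
  change T (w ∘ Sum.inl) i + 0 + 0 = _
  simp

@[simp] theorem tri_inr (T X S : EndPi ι E) (w : ι ⊕ ι → E) (i : ι) :
    tri T X S w (Sum.inr i) = X (w ∘ Sum.inl) i + S (w ∘ Sum.inr) i := by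
  change 0 + X (w ∘ Sum.inl) i + S (w ∘ Sum.inr) i = _
  simp

@[simp] theorem tri_comp_inl (T X S : EndPi ι E) (w : ι ⊕ ι → E) :
    (tri T X S w) ∘ Sum.inl = T (w ∘ Sum.inl) := funext fun i => tri_inl T X S w i

@[simp] theorem tri_comp_inr (T X S : EndPi ι E) (w : ι ⊕ ι → E) :
    (tri T X S w) ∘ Sum.inr = X (w ∘ Sum.inl) + S (w ∘ Sum.inr) :=
  funext fun i => tri_inr T X S w i

theorem tri_apply (T X S : EndPi ι E) (w : ι ⊕ ι → E) :
    tri T X S w = Sum.elim (T (w ∘ Sum.inl)) (X (w ∘ Sum.inl) + S (w ∘ Sum.inr)) := by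
  ext i
  rcases i with i | i <;> simp

theorem tri_add (T X S T' X' S' : EndPi ι E) :
    tri T X S + tri T' X' S' = tri (T + T') (X + X') (S + S') := by
  ext w i
  rcases i with i | i
  · simp
  · simp; abel

theorem tri_smul (c : ℂ) (T X S : EndPi ι E) :
    c • tri T X S = tri (c • T) (c • X) (c • S) := by
  ext w i
  rcases i with i | i <;> simp

theorem tri_zero : tri (0 : EndPi ι E) 0 0 = 0 := by
  ext w i
  rcases i with i | i <;> simp

theorem tri_one : tri (1 : EndPi ι E) 0 1 = 1 := by
  ext w i
  rcases i with i | i <;> simp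

theorem tri_mul (T X S T' X' S' : EndPi ι E) :
    tri T X S * tri T' X' S' = tri (T * T') (X * T' + S * X') (S * S') := by
  ext w i
  rcases i with i | i
  · simp
  · simp; abel

/-- The lower left entry of a `2 × 2` matrix of operators. -/
def lowerLeft (P : EndPi (ι ⊕ ι) E) : EndPi ι E := blockSnd ∘L P ∘L blockInl

theorem lowerLeft_tri (T X S : EndPi ι E) : lowerLeft (tri T X S) = X := by
  ext x i
  have h1 : (blockInl x : ι ⊕ ι → E) ∘ Sum.inl = x := rfl
  have h2 : (blockInl x : ι ⊕ ι → E) ∘ Sum.inr = 0 := rfl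
  change tri T X S (blockInl x) (Sum.inr i) = X x i
  rw [tri_inr, h1, h2, map_zero, Pi.zero_apply, add_zero]

variable [Fintype ι]

theorem continuous_lowerLeft : Continuous (lowerLeft (ι := ι) (E := E)) := by
  unfold lowerLeft
  fun_prop

theorem continuous_tri {Y : Type*} [TopologicalSpace Y] {T X S : Y → EndPi ι E}
    (hT : Continuous T) (hX : Continuous X) (hS : Continuous S) :
    Continuous fun y => tri (T y) (X y) (S y) := by
  unfold tri
  fun_prop

variable (ι E) in
theorem exists_norm_tri_le :
    ∃ K : ℝ, 0 ≤ K ∧ ∀ T X S : EndPi ι E, ‖tri T X S‖ ≤ K * (‖T‖ + ‖X‖ + ‖S‖) := by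
  have hle : ∀ (i : (ι → E) →L[ℂ] (ι ⊕ ι → E)) (T : EndPi ι E) (f : (ι ⊕ ι → E) →L[ℂ] (ι → E)),
      ‖i ∘L T ∘L f‖ ≤ ‖i‖ * (‖T‖ * ‖f‖) := fun i T f =>
    (i.opNorm_comp_le _).trans (by gcongr; exact T.opNorm_comp_le f)
  refine ⟨(‖(blockInl : (ι → E) →L[ℂ] (ι ⊕ ι → E))‖ + ‖(blockInr : (ι → E) →L[ℂ] (ι ⊕ ι → E))‖) *
    (‖(blockFst : (ι ⊕ ι → E) →L[ℂ] (ι → E))‖ + ‖(blockSnd : (ι ⊕ ι → E) →L[ℂ] (ι → E))‖),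
    by positivity, fun T X S => ?_⟩
  have h1 := hle blockInl T blockFst
  have h2 := hle blockInr X blockFst
  have h3 := hle blockInr S blockSnd
  refine (norm_add₃_le.trans (add_le_add_three h1 h2 h3)).trans ?_
  have h4 : ∀ a b c d x y z : ℝ, 0 ≤ a → 0 ≤ b → 0 ≤ c → 0 ≤ d → 0 ≤ x → 0 ≤ y → 0 ≤ z →
      a * (x * c) + b * (y * c) + b * (z * d) ≤ (a + b) * (c + d) * (x + y + z) := by
    intro a b c d x y z ha hb hc hd hx hy hz
    rw [← sub_nonneg]
    have : (a + b) * (c + d) * (x + y + z) - (a * (x * c) + b * (y * c) + b * (z * d)) =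
      a * d * x + b * (c + d) * x + a * (c + d) * y + b * d * y + a * (c + d) * z + b * c * z := by
      ring
    rw [this]; positivity
  exact h4 _ _ _ _ _ _ _ (norm_nonneg _) (norm_nonneg _) (norm_nonneg _) (norm_nonneg _)
    (norm_nonneg _) (norm_nonneg _) (norm_nonneg _)

end Block

/-! ### Growth of powers of a triangular matrix -/

section PowerGrowth

/-- The powers of `x` grow no faster than those of `r`. -/
def PowBound {R : Type*} [NormedRing R] (x : R) (r : ℝ) : Prop :=
  ∃ C : ℝ, 0 ≤ C ∧ ∀ n : ℕ, ‖x ^ n‖ ≤ C * r ^ n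

theorem PowBound.conj {R : Type*} [NormedRing R] {x s : R} {r : ℝ} (h : PowBound x r)
    (hs : s * s = 1) : PowBound (s * x * s) r := by
  obtain ⟨C, hC0, hC⟩ := h
  refine ⟨‖s‖ * C * ‖s‖, by positivity, fun n => ?_⟩
  have h1 : (s * x * s) ^ n = s * x ^ n * s := by
    induction n with
    | zero => simp [hs]
    | succ n ih =>
      rw [pow_succ, ih, pow_succ]
      calc s * x ^ n * s * (s * x * s) = s * x ^ n * (s * s) * x * s := by noncomm_ring
        _ = _ := by rw [hs]; noncomm_ring
  rw [h1]
  calc ‖s * x ^ n * s‖ ≤ ‖s‖ * ‖x ^ n‖ * ‖s‖ :=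
        (norm_mul_le _ _).trans (by gcongr; exact norm_mul_le _ _)
    _ ≤ ‖s‖ * (C * r ^ n) * ‖s‖ := by gcongr; exact hC n
    _ = _ := by ring

/-- Bernoulli's inequality for `(s / r) ^ n`. -/
theorem natCast_mul_pow_le {r s : ℝ} (hr : 0 < r) (hrs : r < s) (n : ℕ) :
    n * r ^ n ≤ (s / r - 1)⁻¹ * s ^ n := by
  have hδ : 0 < s / r - 1 := by rw [sub_pos, one_lt_div hr]; exact hrs
  have h := one_add_mul_le_pow (a := s / r - 1) (by linarith) n
  rw [add_sub_cancel, div_pow, le_div_iff₀ (by positivity)] at h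
  rw [inv_mul_eq_div, le_div_iff₀ hδ]
  nlinarith [pow_pos hr n]

/-- The corner of the `n`-th power is the sum of the `n` products `S^i X T^(n-1-i)`, each of size at
most `C' ‖X‖ C r^(n-1)`. The factor `n` is absorbed by passing from `r` to `s`. -/
theorem PowBound.triangular {ι E : Type*} [NormedAddCommGroup E] [NormedSpace ℂ E] [Fintype ι]
    {T X S : EndPi ι E} {r s : ℝ} (hT : PowBound T r) (hS : PowBound S r) (hr : 0 < r)
    (hrs : r < s) : PowBound (tri T X S) s := by
  obtain ⟨C, hC0, hC⟩ := hT
  obtain ⟨C', hC0', hC'⟩ := hS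
  obtain ⟨K, hK0, hK⟩ := exists_norm_tri_le ι E
  set L := C' * ‖X‖ * C / r with hL
  have hL0 : 0 ≤ L := by positivity
  -- The induction carries `Y * T ^ m` for all `m`: bounding `Y * T` by `‖Y‖ * ‖T‖` would replace
  -- the rate `r` by `‖T‖`.
  have key : ∀ n : ℕ, ∃ Y : EndPi ι E, tri T X S ^ n = tri (T ^ n) Y (S ^ n) ∧
      ∀ m : ℕ, ‖Y * T ^ m‖ ≤ n * L * r ^ (n + m) := by
    intro n
    induction n with
    | zero => exact ⟨0, by simp [tri_one], fun m => by simp⟩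
    | succ n ih =>
      obtain ⟨Y, hY, hb⟩ := ih
      refine ⟨Y * T + S ^ n * X, by rw [pow_succ, hY, tri_mul, ← pow_succ, ← pow_succ], fun m => ?_⟩
      have h1 : (Y * T + S ^ n * X) * T ^ m = Y * T ^ (m + 1) + S ^ n * X * T ^ m := by
        rw [add_mul, mul_assoc Y, ← pow_succ']
      calc ‖(Y * T + S ^ n * X) * T ^ m‖ ≤ ‖Y * T ^ (m + 1)‖ + ‖S ^ n‖ * ‖X‖ * ‖T ^ m‖ := by
            rw [h1]
            refine (norm_add_le _ _).trans ?_
            gcongr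
            exact (norm_mul_le _ _).trans (by gcongr; exact norm_mul_le _ _)
        _ ≤ n * L * r ^ (n + (m + 1)) + C' * r ^ n * ‖X‖ * (C * r ^ m) := by
            gcongr
            · exact hb _
            · exact hC' n
            · exact hC m
        _ = (n + 1 : ℕ) * L * r ^ (n + 1 + m) := by
            rw [hL]; push_cast; field_simp; ring
  refine ⟨K * (C + (s / r - 1)⁻¹ * L + C'), ?_, fun n => ?_⟩
  · have hδ : 0 < s / r - 1 := by rw [sub_pos, one_lt_div hr]; exact hrs
    positivity
  · obtain ⟨Y, hY, hb⟩ := key n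
    have h0 := hb 0
    rw [pow_zero, mul_one, add_zero] at h0
    have hle : r ^ n ≤ s ^ n := by gcongr
    have h2 := natCast_mul_pow_le hr hrs n
    calc ‖tri T X S ^ n‖ ≤ K * (‖T ^ n‖ + ‖Y‖ + ‖S ^ n‖) := by rw [hY]; exact hK _ _ _
      _ ≤ K * (C * s ^ n + (s / r - 1)⁻¹ * L * s ^ n + C' * s ^ n) := by
          gcongr
          · exact (hC n).trans (by gcongr)
          · refine h0.trans ?_
            calc n * L * r ^ n = L * (n * r ^ n) := by ring
              _ ≤ L * ((s / r - 1)⁻¹ * s ^ n) := by gcongr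
              _ = _ := by ring
          · exact (hC' n).trans (by gcongr)
      _ = _ := by ring

end PowerGrowth

/-! Compression of operators by commuting idempotents. -/

section Compress

/-- The sum of the compressions of `x` by `p q` and by `(1 - p) q'`. -/
def compress {R : Type*} [Ring R] (p q q' x : R) : R :=
  p * q * x * (p * q) + (1 - p) * q' * x * ((1 - p) * q')

variable {R : Type*} [Ring R] {p q q' x y : R}

theorem compress_add : compress p q q' (x + y) = compress p q q' x + compress p q q' y := by
  unfold compress; noncomm_ring

theorem compress_zero : compress p q q' 0 = 0 := by
  simp [compress]

/-- The relation `p x p = x p` says that `x` is block triangular for `p`, and the diagonal blocks of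
triangular matrices multiply. With `a = p q` and `b = (1 - p) q'` it reads `a y a = y a` and `b x b
= b x`. The mixed products vanish because `a b = b a = 0`. -/
theorem compress_mul (hp : p * p = p) (hq : q * q = q) (hq' : q' * q' = q')
    (hpq : p * q = q * p) (hpq' : p * q' = q' * p) (hxp : p * x * p = x * p)
    (hyp : p * y * p = y * p) (hxq : x * q = q * x) (hxq' : x * q' = q' * x)
    (hyq : y * q = q * y) :
    compress p q q' (x * y) = compress p q q' x * compress p q q' y := by
  have haa : ∀ z, p * z * p = z * p → z * q = q * z →
      p * q * z * (p * q) = z * (p * q) := fun z h1 h2 => by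
    calc p * q * z * (p * q) = p * (q * z) * (p * q) := by simp only [mul_assoc]
      _ = p * z * (q * p) * q := by rw [← h2]; simp only [mul_assoc]
      _ = p * z * p * (q * q) := by rw [← hpq]; simp only [mul_assoc]
      _ = z * (p * q) := by rw [h1, hq, mul_assoc]
  have hbb : ∀ z, p * z * p = z * p → z * q' = q' * z →
      (1 - p) * q' * z * ((1 - p) * q') = (1 - p) * q' * z := fun z h1 h2 => by
    have h3 : (1 - p) * z * (1 - p) = (1 - p) * z := by
      calc (1 - p) * z * (1 - p) = (1 - p) * z - (z * p - p * z * p) := by noncomm_ring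
        _ = _ := by rw [h1]; noncomm_ring
    have h4 : (1 - p) * q' = q' * (1 - p) := by rw [sub_mul, mul_sub, hpq']; simp
    calc (1 - p) * q' * z * ((1 - p) * q') = q' * ((1 - p) * z * (1 - p)) * q' := by
          nth_rewrite 1 [h4]; simp only [mul_assoc]
      _ = (q' * (1 - p)) * (z * q') := by rw [h3]; noncomm_ring
      _ = (1 - p) * (q' * q') * z := by rw [← h4, h2]; noncomm_ring
      _ = _ := by rw [hq']
  have hab : p * q * ((1 - p) * q') = 0 := by
    calc p * q * ((1 - p) * q') = (q * p - q * (p * p)) * q' := by rw [hpq]; noncomm_ring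
      _ = 0 := by rw [hp, sub_self, zero_mul]
  have hba : (1 - p) * q' * (p * q) = 0 := by
    calc (1 - p) * q' * (p * q) = (1 - p) * (q' * p) * q := by noncomm_ring
      _ = (p - p * p) * q' * q := by rw [← hpq']; noncomm_ring
      _ = 0 := by rw [hp, sub_self, zero_mul, zero_mul]
  have haa1 : p * q * (p * q) = p * q := by simpa using haa 1 (by simpa using hp) (by simp)
  have hbb1 : (1 - p) * q' * ((1 - p) * q') = (1 - p) * q' := by
    simpa using hbb 1 (by simpa using hp) (by simp)
  have hax := haa x hxp hxq
  have hay := haa y hyp hyq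
  have hbx := hbb x hxp hxq'
  unfold compress
  generalize p * q = a at *
  generalize (1 - p) * q' = b at *
  have e1 : a * (x * y) * a = (a * x * a) * (a * y * a) :=
    calc a * (x * y) * a = a * x * (y * a) := by noncomm_ring
      _ = (a * x) * (a * y * a) := by rw [hay]
      _ = (a * x) * (a * (a * y * a)) := by
        rw [← mul_assoc a (a * y), ← mul_assoc a a, haa1]
      _ = _ := by noncomm_ring
  have e2 : b * (x * y) * b = (b * x * b) * (b * y * b) :=
    calc b * (x * y) * b = (b * x) * (y * b) := by noncomm_ring
      _ = (b * x * b) * (y * b) := by rw [hbx]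
      _ = (b * x * (b * b)) * (y * b) := by
        rw [hbb1]
      _ = _ := by noncomm_ring
  rw [e1, e2]
  have e3 : (a * x * a) * (b * y * b) = 0 := by
    calc _ = a * x * (a * b) * (y * b) := by noncomm_ring
      _ = 0 := by rw [hab]; simp
  have e4 : (b * x * b) * (a * y * a) = 0 := by
    calc _ = b * x * (b * a) * (y * a) := by noncomm_ring
      _ = 0 := by rw [hba]; simp
  rw [add_mul, mul_add, mul_add, e3, e4]
  simp

/-- A compression is block diagonal for `p`. This is what allows `p` to play the role of `q` at the
next level. -/
theorem compress_comm (hp : p * p = p) (hpq : p * q = q * p) (hpq' : p * q' = q' * p) :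
    compress p q q' x * p = p * compress p q q' x := by
  have h1 : p * q * p = p * q := by rw [mul_assoc, ← hpq, ← mul_assoc, hp]
  have h2 : (1 - p) * q' * p = 0 := by
    rw [mul_assoc, ← hpq', ← mul_assoc, sub_mul, one_mul, hp, sub_self, zero_mul]
  calc compress p q q' x * p
      = p * q * x * (p * q * p) + (1 - p) * q' * x * ((1 - p) * q' * p) := by
        unfold compress; noncomm_ring
    _ = p * q * x * (p * q) := by rw [h1, h2]; simp
    _ = (p * p) * q * x * (p * q) + (p - p * p) * q' * x * ((1 - p) * q') := by rw [hp]; simp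
    _ = _ := by unfold compress; noncomm_ring

theorem compress_conj {s : R} (hp : s * p = p * s) (hq : s * q = q * s)
    (hq' : s * q' = q' * s) :
    compress p q q' (s * x * s) = s * compress p q q' x * s := by
  have h1 : s * (p * q) = p * q * s := by rw [← mul_assoc, hp, mul_assoc, hq, mul_assoc]
  have h2 : s * ((1 - p) * q') = (1 - p) * q' * s := by
    rw [← mul_assoc, mul_sub, mul_one, hp, mul_assoc, ← hq']; noncomm_ring
  unfold compress
  calc _ = (p * q * s) * x * (s * (p * q)) + ((1 - p) * q' * s) * x * (s * ((1 - p) * q')) := by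
        noncomm_ring
    _ = _ := by rw [← h1, ← h2]; nth_rewrite 2 [h1]; nth_rewrite 2 [h2]; simp only [mul_assoc, mul_add, add_mul]

end Compress


/-! ### The resolvent and the Woronowicz projection as bounded operators -/

section ResolventData

variable {B E : Type*} [NonUnitalCStarAlgebra B] [PartialOrder B] [StarOrderedRing B]
  [NormedAddCommGroup E] [NormedSpace ℂ E] [SMul Bᵐᵒᵖ E] [CStarModule Bᵐᵒᵖ E]

variable (B) in
/-- `D` is densely defined and closed, with `R = (1 + D²)⁻¹` and `Q = D (1 + D²)⁻¹` bounded and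
symmetric. -/
structure ResolventData (D : E →ₗ.[ℂ] E) (R Q : E →L[ℂ] E) : Prop where
  dense : Dense (D.domain : Set E)
  closed : IsClosed (D.graph : Set (E × E))
  resolventSq_eq : ∀ x, resolventSq D x = R x
  mem_left : ∀ x, R x ∈ D.domain
  opFun_left : ∀ x, opFun D (R x) = Q x
  mem_right : ∀ x, Q x ∈ D.domain
  opFun_right : ∀ x, opFun D (Q x) = x - R x
  left_apply : ∀ x, x ∈ D.domain → opFun D x ∈ D.domain → R (x + opFun D (opFun D x)) = x
  inner_left : ∀ x y, inner Bᵐᵒᵖ (R x) y = inner Bᵐᵒᵖ x (R y)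
  inner_right : ∀ x y, inner Bᵐᵒᵖ (Q x) y = inner Bᵐᵒᵖ x (Q y)

theorem IsSelfAdjointOp.exists_resolventData [CompleteSpace E] {D : E →ₗ.[ℂ] E}
    (hS : IsSelfAdjointOp B D) (hD : IsRegular B D) :
    ∃ R Q : E →L[ℂ] E, ResolventData B D R Q := by
  have hspec : ∀ y, resolventSq D y ∈ D.domain ∧ opFun D (resolventSq D y) ∈ D.domain ∧
      resolventSq D y + opFun D (opFun D (resolventSq D y)) = y := fun y => by
    obtain ⟨x, h1, h2, h3⟩ := hS.exists_resolventSq hD y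
    rw [hS.resolventSq_unique h1 h2 h3]
    exact ⟨h1, h2, h3⟩
  have hadd : ∀ x y, resolventSq D (x + y) = resolventSq D x + resolventSq D y := fun x y => by
    obtain ⟨x1, x2, x3⟩ := hspec x
    obtain ⟨y1, y2, y3⟩ := hspec y
    refine hS.resolventSq_unique (add_mem x1 y1) (by rw [opFun_add x1 y1]; exact add_mem x2 y2) ?_
    rw [opFun_add x1 y1, opFun_add x2 y2, add_add_add_comm, x3, y3]
  have hsmul : ∀ (c : ℂ) x, resolventSq D (c • x) = c • resolventSq D x := fun c x => by
    obtain ⟨x1, x2, x3⟩ := hspec x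
    refine hS.resolventSq_unique (D.domain.smul_mem c x1)
      (by rw [opFun_smul c x1]; exact D.domain.smul_mem c x2) ?_
    rw [opFun_smul c x1, opFun_smul c x2, ← smul_add, x3]
  have hnorm : ∀ x, ‖resolventSq D x‖ ≤ ‖x‖ ∧ ‖opFun D (resolventSq D x)‖ ≤ ‖x‖ := fun x => by
    obtain ⟨x1, x2, x3⟩ := hspec x
    have := hS.norm_le x1 x2
    rwa [x3] at this
  let R : E →L[ℂ] E := LinearMap.mkContinuous
    { toFun := resolventSq D, map_add' := hadd, map_smul' := hsmul } 1
    (fun x => by simpa using (hnorm x).1)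
  let Q : E →L[ℂ] E := LinearMap.mkContinuous
    { toFun := fun x => opFun D (resolventSq D x)
      map_add' := fun x y => by rw [hadd, opFun_add (hspec x).1 (hspec y).1]
      map_smul' := fun c x => by rw [hsmul, opFun_smul c (hspec x).1, RingHom.id_apply] } 1
    (fun x => by simpa using (hnorm x).2)
  refine ⟨R, Q, hD.dense_domain, hD.closed, fun x => rfl, fun x => (hspec x).1, fun x => rfl,
    fun x => (hspec x).2.1, fun x => ?_, fun x h1 h2 => hS.resolventSq_unique h1 h2 rfl,
    fun x y => ?_, fun x y => ?_⟩
  · exact eq_sub_of_add_eq' (hspec x).2.2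
  · obtain ⟨x1, x2, x3⟩ := hspec x
    obtain ⟨y1, y2, y3⟩ := hspec y
    change inner Bᵐᵒᵖ (resolventSq D x) y = inner Bᵐᵒᵖ x (resolventSq D y)
    nth_rewrite 1 [← y3]
    nth_rewrite 2 [← x3]
    rw [CStarModule.inner_add_left, CStarModule.inner_add_right, ← hS.inner_opFun x1 y2,
      ← hS.inner_opFun x2 y1]
  · obtain ⟨x1, x2, x3⟩ := hspec x
    obtain ⟨y1, y2, y3⟩ := hspec y
    change inner Bᵐᵒᵖ (opFun D (resolventSq D x)) y = inner Bᵐᵒᵖ x (opFun D (resolventSq D y))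
    nth_rewrite 1 [← y3]
    nth_rewrite 2 [← x3]
    rw [CStarModule.inner_add_left, CStarModule.inner_add_right, hS.inner_opFun x1 y1,
      hS.inner_opFun x2 y2]

/-- The vectors of `⨁_{i ∈ ι} E` whose components lie in `Dom D`. -/
def InDom {ι : Type*} (D : E →ₗ.[ℂ] E) (x : ι → E) : Prop := ∀ i, x i ∈ D.domain

/-- The diagonal operator `D` in `⨁_{i ∈ ι} E`. -/
noncomputable def opPi {ι : Type*} (D : E →ₗ.[ℂ] E) (x : ι → E) : ι → E := fun i => opFun D (x i)

/-- `T` preserves `Dom D`, and `D T = c T D` there. -/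
def Intertwines {ι : Type*} (D : E →ₗ.[ℂ] E) (c : ℂ) (T : EndPi ι E) : Prop :=
  ∀ x, InDom D x → InDom D (T x) ∧ opPi D (T x) = c • T (opPi D x)

section Wor

variable {ι : Type*} {D : E →ₗ.[ℂ] E} {R Q : E →L[ℂ] E}

theorem InDom.add {x y : ι → E} (hx : InDom D x) (hy : InDom D y) : InDom D (x + y) :=
  fun i => add_mem (hx i) (hy i)

theorem InDom.sub {x y : ι → E} (hx : InDom D x) (hy : InDom D y) : InDom D (x - y) :=
  fun i => sub_mem (hx i) (hy i)

theorem InDom.smul {x : ι → E} (c : ℂ) (hx : InDom D x) : InDom D (c • x) :=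
  fun i => D.domain.smul_mem c (hx i)

theorem opPi_add {x y : ι → E} (hx : InDom D x) (hy : InDom D y) :
    opPi D (x + y) = opPi D x + opPi D y := funext fun i => opFun_add (hx i) (hy i)

theorem opPi_sub {x y : ι → E} (hx : InDom D x) (hy : InDom D y) :
    opPi D (x - y) = opPi D x - opPi D y := funext fun i => opFun_sub (hx i) (hy i)

theorem opPi_smul {x : ι → E} (c : ℂ) (hx : InDom D x) : opPi D (c • x) = c • opPi D x :=
  funext fun i => opFun_smul c (hx i)

theorem Intertwines.one : Intertwines D 1 (1 : EndPi ι E) := fun x hx => ⟨hx, by simp⟩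

theorem Intertwines.one_sub {T : EndPi ι E} (hT : Intertwines D 1 T) :
    Intertwines D 1 (1 - T) := fun x hx => by
  obtain ⟨h1, h2⟩ := hT x hx
  refine ⟨hx.sub h1, ?_⟩
  rw [sub_apply, one_apply_eq_self, opPi_sub hx h1, h2]
  simp

theorem Intertwines.triDiag {T : EndPi ι E} {c d : ℂ} (hT : Intertwines D c T) :
    Intertwines D c (tri T 0 (d • T)) := fun x hx => by
  obtain ⟨h1, h2⟩ := hT (x ∘ Sum.inl) fun i => hx _
  obtain ⟨h3, h4⟩ := hT (x ∘ Sum.inr) fun i => hx _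
  constructor
  · rintro (i | i)
    · simpa using h1 i
    · simpa using D.domain.smul_mem d (h3 i)
  · ext (i | i)
    · have := congrFun h2 i
      simp only [opPi, tri_inl, Pi.smul_apply] at this ⊢
      exact this
    · have h5 := congrFun h4 i
      have h6 := opFun_smul d (h3 i)
      simp only [opPi, tri_inr, Pi.smul_apply, smul_apply, zero_apply, Pi.zero_apply,
        zero_add] at h5 h6 ⊢
      rw [h6, h5, smul_comm]
      rfl

/-- The diagonal operator with entries `T` in `⨁_{i ∈ ι} E`. -/
def diagPi (ι : Type*) (T : E →L[ℂ] E) : EndPi ι E := .pi fun i => T ∘L .proj i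

@[simp] theorem diagPi_apply (T : E →L[ℂ] E) (x : ι → E) (i : ι) : diagPi ι T x i = T (x i) := rfl

theorem ResolventData.left_opFun (h : ResolventData B D R Q) {x : E} (hx : x ∈ D.domain) :
    R (opFun D x) = Q x := by
  have h1 : opFun D (Q x) ∈ D.domain := by
    rw [h.opFun_right]; exact sub_mem hx (h.mem_left x)
  have h2 := h.left_apply (Q x) (h.mem_right x) h1
  rwa [h.opFun_right, opFun_sub hx (h.mem_left x), h.opFun_left, add_sub_cancel] at h2

theorem ResolventData.right_opFun (h : ResolventData B D R Q) {x : E} (hx : x ∈ D.domain) :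
    Q (opFun D x) = x - R x := by
  rw [← h.opFun_left, h.left_opFun hx, h.opFun_right]

/-- Moving `D` past `T` twice costs `c² = 1`, so `(1 + D²) T R x = T (1 + D²) R x = T x`. -/
theorem Intertwines.left_comm (h : ResolventData B D R Q) {T : EndPi ι E} {c : ℂ}
    (hc : c * c = 1) (hT : Intertwines D c T) (x : ι → E) :
    T (diagPi ι R x) = diagPi ι R (T x) := by
  have h1 : InDom D (diagPi ι R x) := fun i => h.mem_left _
  have h1' : opPi D (diagPi ι R x) = diagPi ι Q x := funext fun i => h.opFun_left _
  have h2 : InDom D (diagPi ι Q x) := fun i => h.mem_right _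
  have h2' : opPi D (diagPi ι Q x) = x - diagPi ι R x := funext fun i => h.opFun_right _
  obtain ⟨h3, h4⟩ := hT _ h1
  obtain ⟨h5, h6⟩ := hT _ h2
  rw [h1'] at h4
  rw [h2', map_sub] at h6
  funext i
  have h7 : opFun D (T (diagPi ι R x) i) ∈ D.domain := by
    have : opFun D (T (diagPi ι R x) i) = c • T (diagPi ι Q x) i := congrFun h4 i
    rw [this]; exact D.domain.smul_mem c (h5 i)
  have h8 : opFun D (opFun D (T (diagPi ι R x) i)) = T x i - T (diagPi ι R x) i := by
    have e1 : opFun D (T (diagPi ι R x) i) = c • T (diagPi ι Q x) i := congrFun h4 i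
    have e2 : opFun D (T (diagPi ι Q x) i) = c • (T x i - T (diagPi ι R x) i) := congrFun h6 i
    rw [e1, opFun_smul c (h5 i), e2, smul_smul, hc, one_smul]
  have h9 := h.left_apply _ (h3 i) h7
  rw [h8, add_sub_cancel] at h9
  exact h9.symm

theorem Intertwines.right_comm (h : ResolventData B D R Q) {T : EndPi ι E} {c : ℂ}
    (hc : c * c = 1) (hT : Intertwines D c T) (x : ι → E) :
    c • T (diagPi ι Q x) = diagPi ι Q (T x) := by
  have h1 : InDom D (diagPi ι R x) := fun i => h.mem_left _
  have h1' : opPi D (diagPi ι R x) = diagPi ι Q x := funext fun i => h.opFun_left _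
  obtain ⟨h3, h4⟩ := hT _ h1
  rw [← h1', ← h4, hT.left_comm h hc]
  exact funext fun i => h.opFun_left _

/-- The Woronowicz projection as a bounded operator. -/
def worPi (ι : Type*) (R Q : E →L[ℂ] E) : EndPi (ι ⊕ ι) E :=
  .pi (Sum.elim (fun i => R ∘L .proj (Sum.inl i) + Q ∘L .proj (Sum.inr i))
    (fun i => Q ∘L .proj (Sum.inl i) + (.proj (Sum.inr i) - R ∘L .proj (Sum.inr i))))

@[simp] theorem worPi_inl (w : ι ⊕ ι → E) (i : ι) :
    worPi ι R Q w (Sum.inl i) = R (w (Sum.inl i)) + Q (w (Sum.inr i)) := rfl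

@[simp] theorem worPi_inr (w : ι ⊕ ι → E) (i : ι) :
    worPi ι R Q w (Sum.inr i) = Q (w (Sum.inl i)) + (w (Sum.inr i) - R (w (Sum.inr i))) := rfl

theorem ResolventData.woronowicz_eq (h : ResolventData B D R Q) :
    woronowicz D ι = worPi ι R Q := by
  ext w i
  rcases i with i | i
  · simp [woronowicz, h.resolventSq_eq, h.opFun_left]
  · simp [woronowicz, h.resolventSq_eq, h.opFun_left, h.opFun_right]

theorem ResolventData.worPi_graph (h : ResolventData B D R Q) (w : ι ⊕ ι → E) (i : ι) :
    worPi ι R Q w (Sum.inl i) ∈ D.domain ∧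
      worPi ι R Q w (Sum.inr i) = opFun D (worPi ι R Q w (Sum.inl i)) := by
  rw [worPi_inl, worPi_inr, opFun_add (h.mem_left _) (h.mem_right _), h.opFun_left, h.opFun_right]
  exact ⟨add_mem (h.mem_left _) (h.mem_right _), rfl⟩

theorem ResolventData.worPi_of_graph (h : ResolventData B D R Q) {w : ι ⊕ ι → E}
    (hw : ∀ i, w (Sum.inl i) ∈ D.domain ∧ w (Sum.inr i) = opFun D (w (Sum.inl i))) :
    worPi ι R Q w = w := by
  ext (i | i)
  · rw [worPi_inl, (hw i).2, h.right_opFun (hw i).1, add_sub_cancel]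
  · rw [worPi_inr, (hw i).2, h.left_opFun (hw i).1, add_sub_cancel]

/-- The values lie in the graph of `D`, and vectors of the graph are fixed. -/
theorem ResolventData.worPi_mul_self (h : ResolventData B D R Q) :
    worPi ι R Q * worPi ι R Q = worPi ι R Q :=
  ContinuousLinearMap.ext fun w => h.worPi_of_graph fun i => h.worPi_graph w i

/-- The diagonal entries of the projection commute with `T`, while the entries `Q` pick up the
factor `c`, which the second diagonal entry `c T` compensates. It is used with `c = 1` for the
projections of the previous level and with `c = -1` for the grading. -/
theorem Intertwines.worPi_comm (h : ResolventData B D R Q) {T : EndPi ι E} {c : ℂ}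
    (hc : c * c = 1) (hT : Intertwines D c T) :
    tri T 0 (c • T) * worPi ι R Q = worPi ι R Q * tri T 0 (c • T) := by
  refine ContinuousLinearMap.ext fun w => ?_
  have e1 : (worPi ι R Q w) ∘ Sum.inl =
      diagPi ι R (w ∘ Sum.inl) + diagPi ι Q (w ∘ Sum.inr) := rfl
  have e2 : (worPi ι R Q w) ∘ Sum.inr =
      diagPi ι Q (w ∘ Sum.inl) + (w ∘ Sum.inr - diagPi ι R (w ∘ Sum.inr)) := rfl
  have f1 := hT.left_comm h hc (w ∘ Sum.inl)
  have f2 := hT.left_comm h hc (w ∘ Sum.inr)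
  have f3 := hT.right_comm h hc (w ∘ Sum.inl)
  have f4 := hT.right_comm h hc (w ∘ Sum.inr)
  have f5 : T (diagPi ι Q (w ∘ Sum.inr)) = c • diagPi ι Q (T (w ∘ Sum.inr)) := by
    rw [← f4, smul_smul, hc, one_smul]
  ext (i | i)
  · change tri T 0 (c • T) (worPi ι R Q w) (Sum.inl i) = worPi ι R Q (tri T 0 (c • T) w) (Sum.inl i)
    rw [tri_inl, worPi_inl, e1, map_add, f1, f5]
    simp
  · change tri T 0 (c • T) (worPi ι R Q w) (Sum.inr i) = worPi ι R Q (tri T 0 (c • T) w) (Sum.inr i)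
    rw [tri_inr, worPi_inr, e1, e2, smul_apply, map_add T, map_sub, f2, smul_add, f3]
    simp [smul_sub]

theorem ResolventData.intertwines_worPi (h : ResolventData B D R Q) :
    Intertwines D 1 (worPi ι R Q) := fun w hw => by
  constructor
  · rintro (i | i)
    · exact add_mem (h.mem_left _) (h.mem_right _)
    · exact add_mem (h.mem_right _) (sub_mem (hw _) (h.mem_left _))
  · ext (i | i)
    · simp only [opPi, worPi_inl, Pi.smul_apply, one_smul]
      rw [opFun_add (h.mem_left _) (h.mem_right _), h.opFun_left, h.opFun_right,
        h.left_opFun (hw _), h.right_opFun (hw _)]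
    · simp only [opPi, worPi_inr, Pi.smul_apply, one_smul]
      rw [opFun_add (h.mem_right _) (sub_mem (hw _) (h.mem_left _)),
        opFun_sub (hw _) (h.mem_left _), h.opFun_left, h.opFun_right, h.left_opFun (hw _),
        h.right_opFun (hw _)]

theorem ResolventData.isAdjointable_worPi [Fintype ι] (h : ResolventData B D R Q) :
    IsAdjointable B (worPi ι R Q) := by
  refine ⟨worPi ι R Q, fun x y => ?_⟩
  simp only [Fintype.sum_sum_type, worPi_inl, worPi_inr, CStarModule.inner_add_left,
    CStarModule.inner_add_right, CStarModule.inner_sub_left, CStarModule.inner_sub_right,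
    h.inner_left, h.inner_right, Finset.sum_add_distrib, Finset.sum_sub_distrib]
  abel

end Wor

end ResolventData


/-! ### One step of the construction: from `θ_n` to `π_{n+1}` and `θ_{n+1}` -/

section Level

variable {B E : Type*} [NonUnitalCStarAlgebra B] [PartialOrder B] [StarOrderedRing B]
  [NormedAddCommGroup E] [NormedSpace ℂ E] [SMul Bᵐᵒᵖ E] [CStarModule Bᵐᵒᵖ E]
  {ι : Type*} [Fintype ι] {D : E →ₗ.[ℂ] E} {R Q : E →L[ℂ] E}

theorem isCommutator_iff {T S X : EndPi ι E} : IsCommutator B D T S X ↔ IsAdjointable B X ∧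
    ∀ x, InDom D x → InDom D (T x) ∧ opPi D (T x) = S (opPi D x) + X x := by
  refine and_congr_right fun _ => forall_congr' fun x => forall_congr' fun _ => ?_
  rw [forall_and]
  refine and_congr_right fun _ => ?_
  rw [funext_iff]
  exact forall_congr' fun i => sub_eq_iff_eq_add'

theorem IsAdjointable.zero : IsAdjointable B (0 : EndPi ι E) := ⟨0, fun x y => by simp⟩

theorem IsAdjointable.one : IsAdjointable B (1 : EndPi ι E) := ⟨id, fun x y => by simp⟩

theorem IsAdjointable.clm_add {X Y : EndPi ι E} (hX : IsAdjointable B X)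
    (hY : IsAdjointable B Y) : IsAdjointable B (X + Y : EndPi ι E) := hX.add hY

theorem IsAdjointable.clm_smul {X : EndPi ι E} (hX : IsAdjointable B X) (c : ℂ) :
    IsAdjointable B (c • X : EndPi ι E) := hX.smul c

theorem IsAdjointable.clm_mul {X Y : EndPi ι E} (hX : IsAdjointable B X)
    (hY : IsAdjointable B Y) : IsAdjointable B (X * Y : EndPi ι E) := hX.comp hY

theorem IsAdjointable.clm_sub {X Y : EndPi ι E} (hX : IsAdjointable B X)
    (hY : IsAdjointable B Y) : IsAdjointable B (X - Y : EndPi ι E) := by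
  have h : X - Y = X + (-1 : ℂ) • Y := by ext; simp [sub_eq_add_neg]
  rw [h]
  exact hX.clm_add (hY.clm_smul (-1))

theorem IsAdjointable.tri {T X S : EndPi ι E} (hT : IsAdjointable B T) (hX : IsAdjointable B X)
    (hS : IsAdjointable B S) : IsAdjointable B (tri T X S) := by
  obtain ⟨T', hT⟩ := hT
  obtain ⟨X', hX⟩ := hX
  obtain ⟨S', hS⟩ := hS
  refine ⟨fun w => Sum.elim (T' (w ∘ Sum.inl) + X' (w ∘ Sum.inr)) (S' (w ∘ Sum.inr)),
    fun x y => ?_⟩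
  have h1 := hT (x ∘ Sum.inl) (y ∘ Sum.inl)
  have h2 := hX (x ∘ Sum.inl) (y ∘ Sum.inr)
  have h3 := hS (x ∘ Sum.inr) (y ∘ Sum.inr)
  simp only [Function.comp_apply] at h1 h2 h3
  simp only [Fintype.sum_sum_type, tri_inl, tri_inr, Sum.elim_inl, Sum.elim_inr, Pi.add_apply,
    CStarModule.inner_add_left, CStarModule.inner_add_right, Finset.sum_add_distrib, h1, h2, h3]
  abel

theorem IsCommutator.add {T S X T' S' X' : EndPi ι E} (h : IsCommutator B D T S X)
    (h' : IsCommutator B D T' S' X') :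
    IsCommutator B D (T + T' : EndPi ι E) (S + S' : EndPi ι E) (X + X' : EndPi ι E) := by
  rw [isCommutator_iff] at *
  refine ⟨h.1.clm_add h'.1, fun x hx => ?_⟩
  obtain ⟨h1, h2⟩ := h.2 x hx
  obtain ⟨h1', h2'⟩ := h'.2 x hx
  refine ⟨h1.add h1', ?_⟩
  simp only [add_apply, opPi_add h1 h1', h2, h2']
  abel

theorem IsCommutator.smul {T S X : EndPi ι E} (h : IsCommutator B D T S X) (c : ℂ) :
    IsCommutator B D (c • T : EndPi ι E) (c • S : EndPi ι E) (c • X : EndPi ι E) := by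
  rw [isCommutator_iff] at *
  refine ⟨h.1.clm_smul c, fun x hx => ?_⟩
  obtain ⟨h1, h2⟩ := h.2 x hx
  refine ⟨h1.smul c, ?_⟩
  simp only [smul_apply, opPi_smul c h1, h2, smul_add]

theorem IsCommutator.zero : IsCommutator B D (0 : EndPi ι E) (0 : EndPi ι E) (0 : EndPi ι E) := by
  rw [isCommutator_iff]
  refine ⟨.zero, fun x _ => ⟨fun i => D.domain.zero_mem, ?_⟩⟩
  ext i
  simp [opPi, opFun_zero]

/-- The Leibniz rule. -/
theorem IsCommutator.mul {T S X T' S' X' : EndPi ι E} (h : IsCommutator B D T S X)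
    (h' : IsCommutator B D T' S' X') (hS : IsAdjointable B S) (hT' : IsAdjointable B T') :
    IsCommutator B D (T * T' : EndPi ι E) (S * S' : EndPi ι E) (X * T' + S * X' : EndPi ι E) := by
  rw [isCommutator_iff] at *
  refine ⟨(h.1.clm_mul hT').clm_add (hS.clm_mul h'.1), fun x hx => ?_⟩
  obtain ⟨h1', h2'⟩ := h'.2 x hx
  obtain ⟨h1, h2⟩ := h.2 _ h1'
  refine ⟨h1, ?_⟩
  change opPi D (T (T' x)) = S (S' (opPi D x)) + (X (T' x) + S (X' x))
  rw [h2, h2', map_add]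
  abel

theorem dense_inDom (hd : Dense (D.domain : Set E)) : Dense {x : ι → E | InDom D x} := by
  have := dense_pi (Set.univ : Set ι) (s := fun _ => (D.domain : Set E)) fun _ _ => hd
  exact this.mono fun x (hx : x ∈ Set.univ.pi _) i => hx i (Set.mem_univ i)

theorem eq_of_eqOn_inDom (hd : Dense (D.domain : Set E)) {X Y : EndPi ι E}
    (h : ∀ x, InDom D x → X x = Y x) : X = Y :=
  ContinuousLinearMap.ext (congrFun (Continuous.ext_on (dense_inDom hd) X.continuous Y.continuous
    fun x hx => h x hx))

theorem IsCommutator.unique (hd : Dense (D.domain : Set E)) {T S X X' : EndPi ι E}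
    (h : IsCommutator B D T S X) (h' : IsCommutator B D T S X') : X = X' := by
  rw [isCommutator_iff] at h h'
  refine eq_of_eqOn_inDom hd fun x hx => ?_
  have := (h.2 x hx).2
  rw [(h'.2 x hx).2] at this
  exact (add_left_cancel this).symm

/-- For fixed `x` in the domain, the condition says that `(T x, S D x + X x)` lies, in each
coordinate, in the closed graph of `D`. -/
theorem isClosed_isCommutator [CompleteSpace E] (hc : IsClosed (D.graph : Set (E × E))) :
    IsClosed {P : EndPi ι E × EndPi ι E × EndPi ι E | IsCommutator B D P.1 P.2.1 P.2.2} := by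
  have h1 : {P : EndPi ι E × EndPi ι E × EndPi ι E | IsCommutator B D P.1 P.2.1 P.2.2} =
      {P | IsAdjointable B P.2.2} ∩ ⋂ x : {x : ι → E // InDom D x}, ⋂ i,
        {P | (P.1 x.1 i, P.2.1 (opPi D x.1) i + P.2.2 x.1 i) ∈ D.graph} := by
    ext P
    simp only [Set.mem_ofPred_eq, isCommutator_iff, Set.mem_inter_iff, Set.mem_iInter,
      mem_graph_iff_opFun, Subtype.forall]
    refine and_congr_right fun _ => forall_congr' fun x => forall_congr' fun _ => ?_
    rw [forall_and]
    exact and_congr_right fun _ => funext_iff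
  rw [h1]
  refine ((isClosed_isAdjointable B).preimage (by fun_prop)).inter
    (isClosed_iInter fun x => isClosed_iInter fun i => hc.preimage ?_)
  have hap : ∀ y : ι → E, Continuous fun T : EndPi ι E => T y i := fun y =>
    (continuous_apply i).comp (ContinuousLinearMap.apply ℂ (ι → E) y).continuous
  exact ((hap _).comp continuous_fst).prodMk
    (((hap _).comp (continuous_fst.comp continuous_snd)).add
      ((hap _).comp (continuous_snd.comp continuous_snd)))

/-- `σ` is a grading operator for which `D` is odd, and which acts by `φ` on inner products. -/
structure IsGradingOp (D : E →ₗ.[ℂ] E) (φ : Bᵐᵒᵖ →+ Bᵐᵒᵖ) (σ : EndPi ι E) : Prop where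
  mul_self : σ * σ = 1
  odd : Intertwines D (-1) σ
  inner_eq : ∀ x y : ι → E,
    ∑ i, inner Bᵐᵒᵖ (σ x i) (σ y i) = φ (∑ i, inner Bᵐᵒᵖ (x i) (y i))

variable {φ : Bᵐᵒᵖ →+ Bᵐᵒᵖ} {σ : EndPi ι E}

theorem IsGradingOp.apply_apply (hσ : IsGradingOp D φ σ) (x : ι → E) : σ (σ x) = x :=
  congrArg (fun T : EndPi ι E => T x) hσ.mul_self

/-- `σ` preserves the inner product only up to `φ`, but the two factors cancel: `⟨σXσx, y⟩ = φ⟨Xσx,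
σy⟩ = φ⟨σx, Yσy⟩ = ⟨x, σYσy⟩`. -/
theorem IsGradingOp.isAdjointable (hσ : IsGradingOp D φ σ) {X : EndPi ι E}
    (hX : IsAdjointable B X) : IsAdjointable B (σ * X * σ : EndPi ι E) := by
  obtain ⟨Y, hY⟩ := hX
  refine ⟨fun y => σ (Y (σ y)), fun x y => ?_⟩
  have h1 := hσ.inner_eq (X (σ x)) (σ y)
  have h2 := hσ.inner_eq (σ x) (Y (σ y))
  rw [hσ.apply_apply] at h1 h2
  change ∑ i, inner Bᵐᵒᵖ (σ (X (σ x)) i) (y i) = _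
  rw [h1, h2, hY]

/-- The sign in the second summand is the one for which conjugation turns `π_{n+1}(a)` into
`π_{n+1}` of the image of `a` under the grading, given that `[D, ·]` changes sign; see
`IsLift.conj`. -/
theorem IsGradingOp.next (hσ : IsGradingOp D φ σ) : IsGradingOp D φ (tri σ 0 ((-1 : ℂ) • σ)) where
  mul_self := by
    rw [tri_mul, hσ.mul_self, smul_mul_smul_comm, hσ.mul_self]
    simp [tri_one]
  odd := hσ.odd.triDiag
  inner_eq x y := by
    have h1 := hσ.inner_eq (x ∘ Sum.inl) (y ∘ Sum.inl)
    have h2 := hσ.inner_eq (x ∘ Sum.inr) (y ∘ Sum.inr)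
    simp only [Function.comp_apply] at h1 h2
    simp only [Fintype.sum_sum_type, map_add, ← h1, ← h2]
    simp

/-- The graded commutator of a conjugated pair. -/
theorem IsGradingOp.isCommutator_conj (hσ : IsGradingOp D φ σ) {T S X : EndPi ι E}
    (h : IsCommutator B D T S X) :
    IsCommutator B D (σ * T * σ : EndPi ι E) (σ * S * σ : EndPi ι E)
      ((-1 : ℂ) • (σ * X * σ) : EndPi ι E) := by
  rw [isCommutator_iff] at *
  refine ⟨(hσ.isAdjointable h.1).clm_smul _, fun x hx => ?_⟩
  obtain ⟨h1, h2⟩ := hσ.odd x hx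
  obtain ⟨h3, h4⟩ := h.2 _ h1
  obtain ⟨h5, h6⟩ := hσ.odd _ h3
  refine ⟨h5, ?_⟩
  change opPi D (σ (T (σ x))) = σ (S (σ (opPi D x))) + (-1 : ℂ) • σ (X (σ x))
  rw [h6, h4, h2]
  simp

variable (B) in
/-- `π` is the matrix `(T, 0; [D, T], σ T σ)`. -/
def IsLift (D : E →ₗ.[ℂ] E) (σ T : EndPi ι E) (π : EndPi (ι ⊕ ι) E) : Prop :=
  ∃ X : EndPi ι E, IsCommutator B D T (σ * T * σ : EndPi ι E) X ∧ π = tri T X (σ * T * σ)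

section IsLift

variable {T S : EndPi ι E} {π ρ : EndPi (ι ⊕ ι) E}

theorem IsLift.zero : IsLift B D σ (0 : EndPi ι E) 0 :=
  ⟨0, by simpa using IsCommutator.zero, by simp [tri_zero]⟩

theorem IsLift.add (h : IsLift B D σ T π) (h' : IsLift B D σ S ρ) :
    IsLift B D σ (T + S) (π + ρ) := by
  obtain ⟨X, hX, rfl⟩ := h
  obtain ⟨Y, hY, rfl⟩ := h'
  refine ⟨X + Y, ?_, ?_⟩
  · rw [mul_add, add_mul]; exact hX.add hY
  · rw [mul_add, add_mul, tri_add]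

theorem IsLift.smul (h : IsLift B D σ T π) (c : ℂ) : IsLift B D σ (c • T) (c • π) := by
  obtain ⟨X, hX, rfl⟩ := h
  refine ⟨c • X, ?_, ?_⟩
  · rw [mul_smul_comm, smul_mul_assoc]; exact hX.smul c
  · rw [mul_smul_comm, smul_mul_assoc, tri_smul]

theorem IsGradingOp.conj_mul (hσ : IsGradingOp D φ σ) (T S : EndPi ι E) :
    σ * (T * S) * σ = (σ * T * σ) * (σ * S * σ) := by
  calc σ * (T * S) * σ = σ * T * 1 * (S * σ) := by simp only [mul_one, mul_assoc]
    _ = _ := by rw [← hσ.mul_self]; simp only [mul_assoc]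

theorem IsLift.mul (hσ : IsGradingOp D φ σ) (hT : IsAdjointable B T) (hS : IsAdjointable B S)
    (h : IsLift B D σ T π) (h' : IsLift B D σ S ρ) : IsLift B D σ (T * S) (π * ρ) := by
  obtain ⟨X, hX, rfl⟩ := h
  obtain ⟨Y, hY, rfl⟩ := h'
  refine ⟨X * S + σ * T * σ * Y, ?_, ?_⟩
  · rw [hσ.conj_mul]; exact hX.mul hY (hσ.isAdjointable hT) hS
  · rw [hσ.conj_mul, tri_mul]

theorem IsLift.unique (hd : Dense (D.domain : Set E)) (h : IsLift B D σ T π)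
    (h' : IsLift B D σ T ρ) : π = ρ := by
  obtain ⟨X, hX, rfl⟩ := h
  obtain ⟨Y, hY, rfl⟩ := h'
  rw [hX.unique hd hY]

theorem IsLift.conj (hσ : IsGradingOp D φ σ) (h : IsLift B D σ T π) :
    IsLift B D σ (σ * T * σ)
      (tri σ 0 ((-1 : ℂ) • σ) * π * tri σ 0 ((-1 : ℂ) • σ)) := by
  obtain ⟨X, hX, rfl⟩ := h
  refine ⟨(-1 : ℂ) • (σ * X * σ), hσ.isCommutator_conj hX, ?_⟩
  rw [tri_mul, tri_mul]
  simp only [mul_zero, add_zero, zero_mul, zero_add, smul_mul_assoc, mul_smul_comm, smul_smul,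
    mul_assoc]
  norm_num

/-- The commutator depends continuously on the matrix, being its lower left entry, so closedness is
inherited from `isClosed_isCommutator`. -/
theorem isClosed_isLift [CompleteSpace E] (hc : IsClosed (D.graph : Set (E × E)))
    (σ : EndPi ι E) :
    IsClosed {P : EndPi ι E × EndPi (ι ⊕ ι) E | IsLift B D σ P.1 P.2} := by
  have h1 : {P : EndPi ι E × EndPi (ι ⊕ ι) E | IsLift B D σ P.1 P.2} =
      {P | IsCommutator B D P.1 (σ * P.1 * σ : EndPi ι E) (lowerLeft P.2)} ∩
      {P | P.2 = tri P.1 (lowerLeft P.2) (σ * P.1 * σ)} := by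
    ext P
    constructor
    · rintro ⟨X, hX, hP⟩
      simp only [Set.mem_inter_iff, Set.mem_ofPred_eq]
      rw [hP, lowerLeft_tri]
      exact ⟨hX, rfl⟩
    · rintro ⟨h1, h2⟩
      exact ⟨_, h1, h2⟩
  rw [h1]
  have h2 : Continuous fun P : EndPi ι E × EndPi (ι ⊕ ι) E => lowerLeft P.2 :=
    continuous_lowerLeft.comp continuous_snd
  have h3 : Continuous fun P : EndPi ι E × EndPi (ι ⊕ ι) E => σ * P.1 * σ := by fun_prop
  exact ((isClosed_isCommutator hc).preimage
      (continuous_fst.prodMk (h3.prodMk h2))).inter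
    (isClosed_eq continuous_snd (continuous_tri continuous_fst h2 h3))

/-- The matrix sends `(x, D x)` to `(T x, [D, T] x + σTσ D x) = (T x, D T x)`. -/
theorem IsLift.preserves_graph (hR : ResolventData B D R Q) (h : IsLift B D σ T π) :
    worPi ι R Q * π * worPi ι R Q = π * worPi ι R Q := by
  obtain ⟨X, hX, rfl⟩ := h
  rw [isCommutator_iff] at hX
  refine ContinuousLinearMap.ext fun w => hR.worPi_of_graph ?_
  have hw := hR.worPi_graph w
  obtain ⟨h1, h2⟩ := hX.2 ((worPi ι R Q w) ∘ Sum.inl) fun i => (hw i).1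
  have h3 : opPi D ((worPi ι R Q w) ∘ Sum.inl) = (worPi ι R Q w) ∘ Sum.inr :=
    funext fun i => (hw i).2.symm
  rw [h3] at h2
  intro i
  change tri _ _ _ (worPi ι R Q w) _ ∈ _ ∧ tri _ _ _ (worPi ι R Q w) _ =
    opFun D (tri _ _ _ (worPi ι R Q w) _)
  rw [tri_inl, tri_inr]
  refine ⟨h1 i, ?_⟩
  have h4 := congrFun h2 i
  rw [Pi.add_apply, add_comm] at h4
  exact h4.symm

theorem IsLift.isAdjointable (hσ : IsGradingOp D φ σ) (hT : IsAdjointable B T)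
    (h : IsLift B D σ T π) : IsAdjointable B π := by
  obtain ⟨X, hX, rfl⟩ := h
  exact hT.tri hX.1 (hσ.isAdjointable hT)

/-- As `q` commutes with `D`, `T` and `σ`, it commutes with `[D, T]` on the domain of `D`, hence
everywhere by density. -/
theorem IsLift.commute (hd : Dense (D.domain : Set E)) {q : EndPi ι E} (hq : Intertwines D 1 q)
    (hqσ : σ * q = q * σ) (hqT : T * q = q * T) (h : IsLift B D σ T π) :
    π * tri q 0 q = tri q 0 q * π := by
  obtain ⟨X, hX, rfl⟩ := h
  rw [isCommutator_iff] at hX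
  have h1 : σ * T * σ * q = q * (σ * T * σ) := by
    rw [mul_assoc, hqσ, ← mul_assoc, mul_assoc σ, hqT, ← mul_assoc, hqσ]
    simp only [mul_assoc]
  have h2 : X * q = q * X := by
    refine eq_of_eqOn_inDom hd fun x hx => ?_
    obtain ⟨e1, e2⟩ := hq x hx
    obtain ⟨e3, e4⟩ := hX.2 x hx
    obtain ⟨e5, e6⟩ := hX.2 _ e1
    obtain ⟨e7, e8⟩ := hq _ e3
    have f1 : T (q x) = q (T x) := congrArg (fun P : EndPi ι E => P x) hqT
    have f2 : ∀ y, (σ * T * σ) (q y) = q ((σ * T * σ) y) := fun y =>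
      congrArg (fun P : EndPi ι E => P y) h1
    rw [one_smul] at e2 e8
    rw [f1, e8, e4, e2, f2, map_add] at e6
    exact (add_left_cancel e6).symm
  rw [tri_mul, tri_mul, hqT, h1, h2]
  simp

end IsLift

/-- The grading operator `σ` and the idempotents `q`, `q'` by which the operators are compressed. -/
structure IsLevel (D : E →ₗ.[ℂ] E) (φ : Bᵐᵒᵖ →+ Bᵐᵒᵖ) (σ q q' : EndPi ι E) : Prop where
  grading : IsGradingOp D φ σ
  idem_left : q * q = q
  idem_right : q' * q' = q'
  intertwines_left : Intertwines D 1 q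
  intertwines_right : Intertwines D 1 q'
  comm_left : σ * q = q * σ
  comm_right : σ * q' = q' * σ
  isAdjointable_left : IsAdjointable B q
  isAdjointable_right : IsAdjointable B q'

theorem IsLevel.next {q q' : EndPi ι E} (hR : ResolventData B D R Q) (hL : IsLevel D φ σ q q') :
    IsLevel D φ (tri σ 0 ((-1 : ℂ) • σ)) (worPi ι R Q) (1 - worPi ι R Q) where
  grading := hL.grading.next
  idem_left := hR.worPi_mul_self
  idem_right := by
    have := hR.worPi_mul_self (ι := ι)
    rw [mul_sub, sub_mul, sub_mul, this]; simp
  intertwines_left := hR.intertwines_worPi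
  intertwines_right := hR.intertwines_worPi.one_sub
  comm_left := hL.grading.odd.worPi_comm hR (by norm_num)
  comm_right := by
    rw [mul_sub, sub_mul, hL.grading.odd.worPi_comm hR (by norm_num)]; simp
  isAdjointable_left := hR.isAdjointable_worPi
  isAdjointable_right := IsAdjointable.one.clm_sub hR.isAdjointable_worPi

/-- `p q π q p + p^⊥ q' π q' p^⊥`, for the Woronowicz projection `p`. -/
def compressPi (R Q : E →L[ℂ] E) (q q' : EndPi ι E) (π : EndPi (ι ⊕ ι) E) : EndPi (ι ⊕ ι) E :=
  compress (worPi ι R Q) (tri q 0 q) (tri q' 0 q') π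

section compressPi

variable {q q' T S : EndPi ι E} {π ρ : EndPi (ι ⊕ ι) E}

theorem Intertwines.worPi_comm_tri (hR : ResolventData B D R Q) (hq : Intertwines D 1 q) :
    worPi ι R Q * tri q 0 q = tri q 0 q * worPi ι R Q := by
  have := hq.worPi_comm hR (by norm_num)
  rw [one_smul] at this
  exact this.symm

theorem IsLevel.compressPi_mul (hR : ResolventData B D R Q) (hL : IsLevel D φ σ q q')
    (hT : IsLift B D σ T π) (hS : IsLift B D σ S ρ) (hTq : T * q = q * T) (hTq' : T * q' = q' * T)
    (hSq : S * q = q * S) :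
    compressPi R Q q q' (π * ρ) = compressPi R Q q q' π * compressPi R Q q q' ρ := by
  refine compress_mul hR.worPi_mul_self ?_ ?_ (hL.intertwines_left.worPi_comm_tri hR)
    (hL.intertwines_right.worPi_comm_tri hR) (hT.preserves_graph hR) (hS.preserves_graph hR)
    (hT.commute hR.dense hL.intertwines_left hL.comm_left hTq)
    (hT.commute hR.dense hL.intertwines_right hL.comm_right hTq')
    (hS.commute hR.dense hL.intertwines_left hL.comm_left hSq)
  · rw [tri_mul, hL.idem_left]; simp
  · rw [tri_mul, hL.idem_right]; simp

theorem IsLevel.compressPi_comm (hR : ResolventData B D R Q) (hL : IsLevel D φ σ q q') :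
    compressPi R Q q q' π * worPi ι R Q = worPi ι R Q * compressPi R Q q q' π :=
  compress_comm hR.worPi_mul_self (hL.intertwines_left.worPi_comm_tri hR)
    (hL.intertwines_right.worPi_comm_tri hR)

theorem IsLevel.compressPi_conj (hR : ResolventData B D R Q) (hL : IsLevel D φ σ q q') :
    compressPi R Q q q' (tri σ 0 ((-1 : ℂ) • σ) * π * tri σ 0 ((-1 : ℂ) • σ)) =
      tri σ 0 ((-1 : ℂ) • σ) * compressPi R Q q q' π * tri σ 0 ((-1 : ℂ) • σ) := by
  refine compress_conj (hL.grading.odd.worPi_comm hR (by norm_num)) ?_ ?_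
  · simp only [tri_mul, smul_mul_assoc, mul_smul_comm, hL.comm_left, mul_zero, zero_mul, add_zero]
  · simp only [tri_mul, smul_mul_assoc, mul_smul_comm, hL.comm_right, mul_zero, zero_mul, add_zero]

theorem IsLevel.isAdjointable_compressPi (hR : ResolventData B D R Q) (hL : IsLevel D φ σ q q')
    (hπ : IsAdjointable B π) : IsAdjointable B (compressPi R Q q q' π) := by
  have h1 := hR.isAdjointable_worPi (ι := ι)
  have h2 := IsAdjointable.one.clm_sub h1
  have h3 := hL.isAdjointable_left.tri .zero hL.isAdjointable_left
  have h4 := hL.isAdjointable_right.tri .zero hL.isAdjointable_right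
  exact (((h1.clm_mul h3).clm_mul hπ).clm_mul (h1.clm_mul h3)).clm_add
    (((h2.clm_mul h4).clm_mul hπ).clm_mul (h2.clm_mul h4))

theorem compressPi_add : compressPi R Q q q' (π + ρ) =
    compressPi R Q q q' π + compressPi R Q q q' ρ := compress_add

theorem compressPi_smul (c : ℂ) : compressPi R Q q q' (c • π) = c • compressPi R Q q q' π := by
  simp only [compressPi, compress, mul_smul_comm, smul_mul_assoc, smul_add]

theorem compressPi_zero : compressPi R Q q q' 0 = 0 := compress_zero

theorem continuous_compressPi : Continuous (compressPi R Q q q') := by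
  unfold compressPi compress
  fun_prop

theorem IsLift.pow (hσ : IsGradingOp D φ σ) (hT : IsAdjointable B T) (h : IsLift B D σ T π)
    (n : ℕ) : IsLift B D σ (T ^ (n + 1)) (π ^ (n + 1)) ∧ IsAdjointable B (T ^ (n + 1) : EndPi ι E) := by
  induction n with
  | zero => simpa using ⟨h, hT⟩
  | succ n ih =>
    rw [pow_succ T, pow_succ π]
    exact ⟨ih.1.mul hσ ih.2 hT h, ih.2.clm_mul hT⟩

/-- Only positive exponents are allowed, since the compression of `1` need not be `1`. -/
theorem IsLevel.compressPi_pow (hR : ResolventData B D R Q) (hL : IsLevel D φ σ q q')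
    (hT : IsAdjointable B T) (h : IsLift B D σ T π) (hTq : T * q = q * T)
    (hTq' : T * q' = q' * T) (n : ℕ) :
    compressPi R Q q q' π ^ (n + 1) = compressPi R Q q q' (π ^ (n + 1)) := by
  induction n with
  | zero => simp
  | succ n ih =>
    have h1 := (h.pow hL.grading hT n).1
    have hq : T ^ (n + 1) * q = q * T ^ (n + 1) := Commute.pow_left (show Commute T q from hTq) _
    have hq' : T ^ (n + 1) * q' = q' * T ^ (n + 1) :=
      Commute.pow_left (show Commute T q' from hTq') _
    rw [pow_succ, ih, pow_succ π (n + 1), hL.compressPi_mul hR h1 h hq hq' hTq]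

theorem IsLevel.powBound_compressPi (hR : ResolventData B D R Q) (hL : IsLevel D φ σ q q')
    (hT : IsAdjointable B T) (h : IsLift B D σ T π) (hTq : T * q = q * T)
    (hTq' : T * q' = q' * T) {r : ℝ} (hr : 0 ≤ r) (hπ : PowBound π r) :
    PowBound (compressPi R Q q q' π) r := by
  obtain ⟨C, hC0, hC⟩ := hπ
  set a := worPi ι R Q * tri q 0 q
  set b := (1 - worPi ι R Q) * tri q' 0 q'
  refine ⟨‖(1 : EndPi (ι ⊕ ι) E)‖ + (‖a‖ * C * ‖a‖ + ‖b‖ * C * ‖b‖), by positivity, fun n => ?_⟩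
  rcases n with _ | n
  · rw [pow_zero, pow_zero, mul_one]
    exact le_add_of_nonneg_right (by positivity)
  · rw [hL.compressPi_pow hR hT h hTq hTq']
    have h1 : ∀ c : EndPi (ι ⊕ ι) E, ‖c * π ^ (n + 1) * c‖ ≤ ‖c‖ * C * ‖c‖ * r ^ (n + 1) := fun c =>
      calc ‖c * π ^ (n + 1) * c‖ ≤ ‖c‖ * ‖π ^ (n + 1)‖ * ‖c‖ :=
            (norm_mul_le _ _).trans (by gcongr; exact norm_mul_le _ _)
        _ ≤ ‖c‖ * (C * r ^ (n + 1)) * ‖c‖ := by gcongr; exact hC _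
        _ = _ := by ring
    calc ‖a * π ^ (n + 1) * a + b * π ^ (n + 1) * b‖
        ≤ ‖a‖ * C * ‖a‖ * r ^ (n + 1) + ‖b‖ * C * ‖b‖ * r ^ (n + 1) :=
          (norm_add_le _ _).trans (add_le_add (h1 a) (h1 b))
      _ ≤ _ := by
          rw [← add_mul]
          refine mul_le_mul_of_nonneg_right ?_ (by positivity)
          exact le_add_of_nonneg_left (norm_nonneg (1 : EndPi (ι ⊕ ι) E))

theorem IsLift.powBound (hσ : IsGradingOp D φ σ) (h : IsLift B D σ T π) {r s : ℝ} (hr : 0 < r)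
    (hrs : r < s) (hT : PowBound T r) : PowBound π s := by
  obtain ⟨X, -, rfl⟩ := h
  exact hT.triangular (hT.conj hσ.mul_self) hr hrs

/-- The commutator chosen in `piStep` is automatically bounded, and is determined on the dense
domain of `D`. -/
theorem IsLift.piStep_eq [CompleteSpace E] (hd : Dense (D.domain : Set E))
    (h : IsLift B D σ T π) : piStep B D T (σ * T * σ : EndPi ι E) = π := by
  obtain ⟨X, hX, rfl⟩ := h
  have hex : ∃ X, IsCommutator B D T (σ * T * σ : EndPi ι E) X := ⟨X, hX⟩
  have h1 : commutator B D T (σ * T * σ : EndPi ι E) = X := by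
    rw [commutator, dif_pos hex]
    obtain ⟨Y, hY⟩ := hex.choose_spec.1.exists_clm
    have h2 := hex.choose_spec
    rw [← hY] at h2 ⊢
    rw [IsCommutator.unique hd h2 hX]
  ext w : 1
  rw [piStep, h1, tri_apply]

theorem exists_isLift_iff [CompleteSpace E] :
    (∃ π, IsLift B D σ T π) ↔ ∃ X, IsCommutator B D T (σ * T * σ : EndPi ι E) X := by
  constructor
  · rintro ⟨-, X, hX, -⟩
    exact ⟨X, hX⟩
  · rintro ⟨X, hX⟩
    obtain ⟨Y, rfl⟩ := hX.1.exists_clm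
    exact ⟨_, Y, hX, rfl⟩

end compressPi

end Level


/-! ### The operators `π_1(T), …, π_n(T)` as one family of data -/

section Tower

variable {B E : Type*} [NonUnitalCStarAlgebra B] [PartialOrder B] [StarOrderedRing B]
  [NormedAddCommGroup E] [NormedSpace ℂ E] [SMul Bᵐᵒᵖ E] [CStarModule Bᵐᵒᵖ E]
  {D : E →ₗ.[ℂ] E} {R Q ε : E →L[ℂ] E} {φ : Bᵐᵒᵖ →+ Bᵐᵒᵖ}

section Apply

variable {ι : Type*} [Fintype ι] {σ q q' : EndPi ι E}

theorem diag_eq_tri (q : EndPi ι E) : diag ⇑q = ⇑(tri q 0 q) := by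
  ext w i
  rcases i with i | i <;> simp [diag]

theorem IsLevel.compressPi_apply (hR : ResolventData B D R Q) (hL : IsLevel D φ σ q q')
    (π : EndPi (ι ⊕ ι) E) (w : ι ⊕ ι → E) :
    compressPi R Q q q' π w =
      worPi ι R Q (diag q (π (diag q (worPi ι R Q w)))) +
        (diag q' (π (diag q' (w - worPi ι R Q w))) -
          worPi ι R Q (diag q' (π (diag q' (w - worPi ι R Q w))))) := by
  have hp : ∀ w, worPi ι R Q (tri q 0 q w) = tri q 0 q (worPi ι R Q w) := fun w =>
    congrArg (fun P : EndPi (ι ⊕ ι) E => P w) (hL.intertwines_left.worPi_comm_tri hR)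
  have hp' : ∀ w, worPi ι R Q (tri q' 0 q' w) = tri q' 0 q' (worPi ι R Q w) := fun w =>
    congrArg (fun P : EndPi (ι ⊕ ι) E => P w) (hL.intertwines_right.worPi_comm_tri hR)
  rw [diag_eq_tri, diag_eq_tri, ← hp w, map_sub (tri q' 0 q'), ← hp' w]
  rfl

end Apply

/-- The grading operator of `E_n`. -/
def gradIdx (ε : E →L[ℂ] E) : (n : ℕ) → EndPi (Idx n) E
  | 0 => diagPi (Idx 0) ε
  | n + 1 => (tri (gradIdx ε n) 0 ((-1 : ℂ) • gradIdx ε n) : EndPi (Idx n ⊕ Idx n) E)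

/-- The projection `p_n` on `E_n` (and `1` for `n = 0`). -/
def projIdx (R Q : E →L[ℂ] E) : (n : ℕ) → EndPi (Idx n) E
  | 0 => 1
  | n + 1 => (worPi (Idx n) R Q : EndPi (Idx n ⊕ Idx n) E)

/-- The projection `p_n^⊥` on `E_n` (and `1` for `n = 0`). -/
def coprojIdx (R Q : E →L[ℂ] E) : (n : ℕ) → EndPi (Idx n) E
  | 0 => 1
  | n + 1 => (1 - worPi (Idx n) R Q : EndPi (Idx n ⊕ Idx n) E)

/-- The operator `θ_n(T)` obtained from the operators `j m = π_{m+1}(T)`. -/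
def thetaOf (R Q T : E →L[ℂ] E) (j : ∀ n, EndPi (Idx n ⊕ Idx n) E) : (n : ℕ) → EndPi (Idx n) E
  | 0 => diagPi (Idx 0) T
  | n + 1 => (compressPi R Q (projIdx R Q n) (coprojIdx R Q n) (j n) : EndPi (Idx n ⊕ Idx n) E)

variable (B) in
/-- The operators `j m` are the `π_{m+1}(T)`, for all `m < n`. -/
def IsTower (D : E →ₗ.[ℂ] E) (ε R Q : E →L[ℂ] E) (n : ℕ) (T : E →L[ℂ] E)
    (j : ∀ n, EndPi (Idx n ⊕ Idx n) E) : Prop :=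
  ∀ m < n, IsLift B D (gradIdx ε m) (thetaOf R Q T j m) (j m)

theorem isLevel_idx (hR : ResolventData B D R Q) (hg : IsGradingOp D φ (diagPi (Idx 0) ε)) (n : ℕ) :
    IsLevel D φ (gradIdx ε n) (projIdx R Q n) (coprojIdx R Q n) := by
  induction n with
  | zero => exact ⟨hg, one_mul 1, one_mul 1, .one, .one, by simp [projIdx], by simp [coprojIdx],
      .one, .one⟩
  | succ n ih => exact ih.next hR

variable {T S : E →L[ℂ] E} {j k : ∀ n, EndPi (Idx n ⊕ Idx n) E} {n : ℕ}

/-- This is the hypothesis on `q` and `q'` under which the next compression is multiplicative. It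
holds for any family `j`, because compressions are block diagonal. -/
theorem thetaOf_comm (hR : ResolventData B D R Q) (hg : IsGradingOp D φ (diagPi (Idx 0) ε)) (n : ℕ) :
    thetaOf R Q T j n * projIdx R Q n = projIdx R Q n * thetaOf R Q T j n ∧
    thetaOf R Q T j n * coprojIdx R Q n = coprojIdx R Q n * thetaOf R Q T j n := by
  cases n with
  | zero => simp [projIdx, coprojIdx]
  | succ n =>
    have h : compressPi R Q (projIdx R Q n) (coprojIdx R Q n) (j n) * worPi (Idx n) R Q =
      worPi (Idx n) R Q * compressPi R Q (projIdx R Q n) (coprojIdx R Q n) (j n) :=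
      (isLevel_idx hR hg n).compressPi_comm hR
    refine ⟨h, ?_⟩
    change compressPi R Q (projIdx R Q n) (coprojIdx R Q n) (j n) * (1 - worPi (Idx n) R Q) =
      (1 - worPi (Idx n) R Q) * compressPi R Q (projIdx R Q n) (coprojIdx R Q n) (j n)
    rw [mul_sub, sub_mul, h, mul_one, one_mul]

theorem thetaOf_zero (n : ℕ) : thetaOf R Q 0 0 n = 0 := by
  cases n with
  | zero => rfl
  | succ n => exact compressPi_zero

theorem thetaOf_add (n : ℕ) : thetaOf R Q (T + S) (j + k) n =
    thetaOf R Q T j n + thetaOf R Q S k n := by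
  cases n with
  | zero => rfl
  | succ n => exact compressPi_add

theorem thetaOf_smul (c : ℂ) (n : ℕ) : thetaOf R Q (c • T) (c • j) n =
    c • thetaOf R Q T j n := by
  cases n with
  | zero => rfl
  | succ n => exact compressPi_smul c

theorem IsTower.zero : IsTower B D ε R Q n 0 0 := fun m _ => by
  rw [thetaOf_zero]; exact .zero

theorem IsTower.add (h : IsTower B D ε R Q n T j) (h' : IsTower B D ε R Q n S k) :
    IsTower B D ε R Q n (T + S) (j + k) := fun m hm => by
  rw [thetaOf_add]; exact (h m hm).add (h' m hm)

theorem IsTower.smul (h : IsTower B D ε R Q n T j) (c : ℂ) :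
    IsTower B D ε R Q n (c • T) (c • j) := fun m hm => by
  rw [thetaOf_smul]; exact (h m hm).smul c

theorem IsTower.mono {m : ℕ} (h : IsTower B D ε R Q n T j) (hm : m ≤ n) :
    IsTower B D ε R Q m T j := fun i hi => h i (hi.trans_le hm)

theorem IsTower.isAdjointable (hR : ResolventData B D R Q)
    (hg : IsGradingOp D φ (diagPi (Idx 0) ε)) (hT : IsAdjointable B (diagPi (Idx 0) T))
    (h : IsTower B D ε R Q n T j) : ∀ m ≤ n, IsAdjointable B (thetaOf R Q T j m) := by
  intro m
  induction m with
  | zero => exact fun _ => hT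
  | succ m ih =>
    intro hm
    have hL := isLevel_idx hR hg m
    exact hL.isAdjointable_compressPi hR ((h m hm).isAdjointable hL.grading (ih (Nat.le_of_lt hm)))

theorem IsTower.thetaOf_mul (hR : ResolventData B D R Q)
    (hg : IsGradingOp D φ (diagPi (Idx 0) ε))
    (h : IsTower B D ε R Q n T j) (h' : IsTower B D ε R Q n S k) :
    ∀ m ≤ n, thetaOf R Q (T * S) (j * k) m = thetaOf R Q T j m * thetaOf R Q S k m := by
  intro m hm
  cases m with
  | zero => rfl
  | succ m =>
    have hT := thetaOf_comm (T := T) (j := j) hR hg m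
    have hS := thetaOf_comm (T := S) (j := k) hR hg m
    exact (isLevel_idx hR hg m).compressPi_mul hR (h m hm) (h' m hm) hT.1 hT.2 hS.1

theorem IsTower.mul (hR : ResolventData B D R Q) (hg : IsGradingOp D φ (diagPi (Idx 0) ε))
    (hT : IsAdjointable B (diagPi (Idx 0) T)) (hS : IsAdjointable B (diagPi (Idx 0) S))
    (h : IsTower B D ε R Q n T j) (h' : IsTower B D ε R Q n S k) :
    IsTower B D ε R Q n (T * S) (j * k) := fun m hm => by
  rw [h.thetaOf_mul hR hg h' m hm.le]
  exact (h m hm).mul (isLevel_idx hR hg m).grading (h.isAdjointable hR hg hT m hm.le)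
    (h'.isAdjointable hR hg hS m hm.le) (h' m hm)

/-- The operators `π_{m+1}` for the image of `T` under the grading automorphism. -/
def conjIdx (ε : E →L[ℂ] E) (j : ∀ n, EndPi (Idx n ⊕ Idx n) E) : ∀ n, EndPi (Idx n ⊕ Idx n) E :=
  fun n => tri (gradIdx ε n) 0 ((-1 : ℂ) • gradIdx ε n) * j n *
    tri (gradIdx ε n) 0 ((-1 : ℂ) • gradIdx ε n)

theorem thetaOf_conj (hR : ResolventData B D R Q) (hg : IsGradingOp D φ (diagPi (Idx 0) ε))
    (n : ℕ) : thetaOf R Q (ε * T * ε) (conjIdx ε j) n =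
      gradIdx ε n * thetaOf R Q T j n * gradIdx ε n := by
  cases n with
  | zero => rfl
  | succ n => exact (isLevel_idx hR hg n).compressPi_conj hR

theorem IsTower.conj (hR : ResolventData B D R Q) (hg : IsGradingOp D φ (diagPi (Idx 0) ε))
    (h : IsTower B D ε R Q n T j) : IsTower B D ε R Q n (ε * T * ε) (conjIdx ε j) := fun m hm => by
  rw [thetaOf_conj hR hg]
  exact (h m hm).conj (isLevel_idx hR hg m).grading

/-- The entries of `j` from index `n` on are irrelevant, so towers can be truncated, or extended by
`Function.update`. -/
theorem thetaOf_congr {n : ℕ} (h : ∀ m < n, j m = k m) : thetaOf R Q T j n = thetaOf R Q T k n := by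
  cases n with
  | zero => rfl
  | succ n =>
    change compressPi R Q (projIdx R Q n) (coprojIdx R Q n) (j n) =
      compressPi R Q (projIdx R Q n) (coprojIdx R Q n) (k n)
    rw [h n n.lt_succ_self]

theorem IsTower.congr (h : ∀ m < n, j m = k m) (hj : IsTower B D ε R Q n T j) :
    IsTower B D ε R Q n T k := fun m hm => by
  rw [← thetaOf_congr fun i hi => h i (hi.trans hm), ← h m hm]
  exact hj m hm

theorem IsTower.unique (hR : ResolventData B D R Q) (hj : IsTower B D ε R Q n T j)
    (hk : IsTower B D ε R Q n T k) : ∀ m < n, j m = k m := by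
  intro m
  induction m using Nat.strong_induction_on with
  | _ m ih =>
    intro hm
    have h1 := hj m hm
    rw [thetaOf_congr fun i hi => ih i hi (hi.trans hm)] at h1
    exact h1.unique hR.dense (hk m hm)

theorem continuous_thetaOf (n : ℕ) :
    Continuous fun P : (E →L[ℂ] E) × (∀ n, EndPi (Idx n ⊕ Idx n) E) => thetaOf R Q P.1 P.2 n := by
  cases n with
  | zero =>
    change Continuous fun P : (E →L[ℂ] E) × (∀ n, EndPi (Idx n ⊕ Idx n) E) => diagPi (Idx 0) P.1
    have h : Continuous fun T : E →L[ℂ] E => diagPi (Idx 0) T := by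
      have h1 : ∀ T : E →L[ℂ] E, diagPi (Idx 0) T =
          (.pi fun _ => .id ℂ E : E →L[ℂ] (Idx 0 → E)) ∘L T ∘L .proj (() : Idx 0) := fun T => by
        ext x i; rfl
      simp_rw [h1]
      fun_prop
    exact h.comp continuous_fst
  | succ n =>
    have h : Continuous fun P : (E →L[ℂ] E) × (∀ n, EndPi (Idx n ⊕ Idx n) E) => P.2 n :=
      (continuous_apply n).comp continuous_snd
    exact (continuous_compressPi (R := R) (Q := Q) (q := projIdx R Q n)
      (q' := coprojIdx R Q n)).comp h

theorem isClosed_isTower [CompleteSpace E] (hR : ResolventData B D R Q) (n : ℕ) :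
    IsClosed {P : (E →L[ℂ] E) × (∀ n, EndPi (Idx n ⊕ Idx n) E) |
      IsTower B D ε R Q n P.1 P.2} := by
  have h : {P : (E →L[ℂ] E) × (∀ n, EndPi (Idx n ⊕ Idx n) E) | IsTower B D ε R Q n P.1 P.2} =
      ⋂ m : {m // m < n}, {P | IsLift B D (gradIdx ε m) (thetaOf R Q P.1 P.2 m) (P.2 m)} := by
    ext P; simp [IsTower]
  rw [h]
  exact isClosed_iInter fun m => (isClosed_isLift (B := B) hR.closed (gradIdx ε m)).preimage
    ((continuous_thetaOf (R := R) (Q := Q) m.1).prodMk ((continuous_apply m.1).comp continuous_snd))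

/-- Each triangular step enlarges the rate slightly and compression keeps it. Because the claim is
made for all rates above `c`, the loss disappears in the induction. -/
theorem IsTower.powBound (hR : ResolventData B D R Q) (hg : IsGradingOp D φ (diagPi (Idx 0) ε))
    (hT : IsAdjointable B (diagPi (Idx 0) T)) (h : IsTower B D ε R Q n T j) {c : ℝ} (hc : 0 ≤ c)
    (hb : ∀ r, c < r → PowBound (diagPi (Idx 0) T) r) :
    ∀ m < n, ∀ r, c < r → PowBound (j m) r := by
  have key : ∀ m < n, (∀ r, c < r → PowBound (thetaOf R Q T j m) r) →
      ∀ r, c < r → PowBound (j m) r := fun m hm hΘ r hr => by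
    obtain ⟨s, hs1, hs2⟩ := exists_between hr
    exact (h m hm).powBound (isLevel_idx hR hg m).grading (hc.trans_lt hs1) hs2 (hΘ s hs1)
  have hΘ : ∀ m ≤ n, ∀ r, c < r → PowBound (thetaOf R Q T j m) r := by
    intro m
    induction m with
    | zero => exact fun _ => hb
    | succ m ih =>
      intro hm r hr
      have hcomm := thetaOf_comm (T := T) (j := j) hR hg m
      exact (isLevel_idx hR hg m).powBound_compressPi hR
        (h.isAdjointable hR hg hT m (Nat.le_of_lt hm)) (h m hm) hcomm.1 hcomm.2 (hc.trans hr.le)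
        (key m hm (ih (Nat.le_of_lt hm)) r hr)
  exact fun m hm => key m hm (hΘ m hm.le)

/-- The induction is over all `T` at once, since `theta` at stage `m + 1` also involves `ε T ε`. The
conjugate tower shows that this second operator is `σ θ_m(T) σ`. -/
theorem IsTower.theta_eq [CompleteSpace E] (hR : ResolventData B D R Q)
    (hg : IsGradingOp D φ (diagPi (Idx 0) ε)) (m : ℕ) :
    ∀ (T : E →L[ℂ] E) (j : ∀ n, EndPi (Idx n ⊕ Idx n) E), IsTower B D ε R Q m T j →
      theta B ε D m T = thetaOf R Q T j m := by
  induction m with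
  | zero => exact fun T j _ => rfl
  | succ m ih =>
    intro T j h
    have h1 := ih T j (h.mono m.le_succ)
    have h2 := ih _ _ ((h.mono m.le_succ).conj hR hg)
    rw [thetaOf_conj hR hg] at h2
    have h3 := (h m m.lt_succ_self).piStep_eq hR.dense
    rw [← h1, ← h2] at h3
    have hL := isLevel_idx hR hg m
    have hw := hR.woronowicz_eq (ι := Idx m)
    funext w
    refine Eq.trans ?_ (hL.compressPi_apply hR (j m) w).symm
    rw [← hw, ← h3]
    cases m with
    | zero =>
      -- At the first stage there is no earlier projection, and `q = q' = 1`.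
      have hd : diag ⇑(1 : EndPi (Idx 0) E) = id := by
        rw [diag_eq_tri, tri_one]; rfl
      rw [projIdx, coprojIdx, hd]
      rfl
    | succ m =>
      have hd : diag ⇑(projIdx R Q (m + 1)) =
          diag (ι := Idx (m + 1)) (woronowicz (E := E) D (Idx m)) := by
        rw [hR.woronowicz_eq]; rfl
      have hd' : ∀ v, diag ⇑(coprojIdx R Q (m + 1)) v =
          v - diag (ι := Idx (m + 1)) (woronowicz (E := E) D (Idx m)) v := fun v => by
        rw [hR.woronowicz_eq]
        ext i
        rcases i with i | i <;> rfl
      rw [hd, hd', hd']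
      rfl

theorem isSobolev_iff [CompleteSpace E] (hR : ResolventData B D R Q)
    (hg : IsGradingOp D φ (diagPi (Idx 0) ε)) (n : ℕ) (T : E →L[ℂ] E) :
    IsSobolev B ε D n T ↔ ∃ j, IsTower B D ε R Q n T j := by
  induction n with
  | zero => exact ⟨fun _ => ⟨0, fun m hm => absurd hm m.not_lt_zero⟩, fun _ => trivial⟩
  | succ n ih =>
    have hiff : ∀ j, IsTower B D ε R Q n T j →
        ((∃ X, IsCommutator B D (theta B ε D n T) (theta B ε D n (ε ∘ T ∘ ε)) X) ↔
          ∃ π, IsLift B D (gradIdx ε n) (thetaOf R Q T j n) π) := fun j hj => by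
      have h2 := (hj.conj hR hg).theta_eq hR hg n
      rw [thetaOf_conj hR hg] at h2
      rw [exists_isLift_iff, hj.theta_eq hR hg n, ← h2]
      rfl
    constructor
    · rintro ⟨h1, h2⟩
      obtain ⟨j, hj⟩ := ih.1 h1
      obtain ⟨π, hπ⟩ := (hiff j hj).1 h2
      have hlt : ∀ m < n, j m = Function.update j n π m := fun m hm => by
        rw [Function.update_of_ne hm.ne]
      refine ⟨Function.update j n π, fun m hm => ?_⟩
      rcases Nat.lt_succ_iff_lt_or_eq.1 hm with hm | rfl
      · exact (hj.congr hlt) m hm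
      · rw [← thetaOf_congr hlt, Function.update_self]
        exact hπ
    · rintro ⟨j, hj⟩
      have hj' := hj.mono n.le_succ
      exact ⟨ih.2 ⟨j, hj'⟩, (hiff j hj').2 ⟨j n, hj n n.lt_succ_self⟩⟩

end Tower


/-! ### The graph of `a ↦ (π_1(a), …, π_N(a))` and its growth -/

section Representation

variable {B E : Type*} [NonUnitalCStarAlgebra B] [PartialOrder B] [StarOrderedRing B]
  [NormedAddCommGroup E] [NormedSpace ℂ E] [SMul Bᵐᵒᵖ E] [CStarModule Bᵐᵒᵖ E]
  {D : E →ₗ.[ℂ] E} {R Q ε : E →L[ℂ] E} {φ : Bᵐᵒᵖ →+ Bᵐᵒᵖ}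

/-- Unital `*`-representations of a C*-algebra on a C*-module are contractive. -/
theorem norm_rep_le {U : Type*} [CStarAlgebra U] (ρ : U →ₙₐ[ℂ] (E →L[ℂ] E)) (h1 : ρ 1 = 1)
    (hρ : ∀ (a : U) (x y : E), inner Bᵐᵒᵖ (ρ a x) y = inner Bᵐᵒᵖ x (ρ (star a) y)) (a : U) :
    ‖ρ a‖ ≤ ‖a‖ := by
  let _ := CStarAlgebra.spectralOrder U
  have := CStarAlgebra.spectralOrderedRing U
  refine (ρ a).opNorm_le_bound (norm_nonneg a) fun x => ?_
  -- Writing `‖a‖² - a* a = b* b` gives `‖a‖² ⟨x, x⟩ - ⟨ρ(a) x, ρ(a) x⟩ = ⟨ρ(b) x, ρ(b) x⟩ ≥ 0`.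
  obtain ⟨b, hb⟩ := CStarAlgebra.nonneg_iff_eq_star_mul_self.1
    (sub_nonneg.2 (CStarAlgebra.star_mul_le_algebraMap_norm_sq (a := a)))
  have h2 : inner Bᵐᵒᵖ (ρ b x) (ρ b x) =
      (‖a‖ ^ 2) • inner Bᵐᵒᵖ x x - inner Bᵐᵒᵖ (ρ a x) (ρ a x) := by
    have h3 : (algebraMap ℝ U) (‖a‖ ^ 2) = ((‖a‖ ^ 2 : ℝ) : ℂ) • (1 : U) := by
      rw [Algebra.algebraMap_eq_smul_one, Complex.coe_smul]
    have h4 : ∀ c : U, inner Bᵐᵒᵖ (ρ c x) (ρ c x) = inner Bᵐᵒᵖ x (ρ (star c * c) x) := fun c => by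
      rw [hρ, map_mul]; rfl
    rw [h4, h4, ← hb, map_sub, h3, map_smul, h1, sub_apply, CStarModule.inner_sub_right, smul_apply,
      CStarModule.inner_smul_right_complex, one_apply_eq_self,
      Complex.coe_smul]
  have h5 : inner Bᵐᵒᵖ (ρ a x) (ρ a x) ≤ (‖a‖ ^ 2) • inner Bᵐᵒᵖ x x := by
    rw [← sub_nonneg, ← h2]; exact CStarModule.inner_self_nonneg
  have h6 := CStarAlgebra.norm_le_norm_of_nonneg_of_le CStarModule.inner_self_nonneg h5
  rw [← CStarModule.norm_sq_eq, norm_smul, ← CStarModule.norm_sq_eq, Real.norm_of_nonneg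
    (by positivity), ← mul_pow] at h6
  exact (pow_le_pow_iff_left₀ (norm_nonneg _) (by positivity) two_ne_zero).1 h6

/-- The family of operators `v`, extended by `0`. -/
noncomputable def extendZero {N : ℕ} (v : ∀ m : Fin N, EndPi (Idx m ⊕ Idx m) E) (m : ℕ) :
    EndPi (Idx m ⊕ Idx m) E :=
  if h : m < N then v ⟨m, h⟩ else 0

theorem extendZero_of_lt {N : ℕ} (v : ∀ m : Fin N, EndPi (Idx m ⊕ Idx m) E) {m : ℕ} (h : m < N) :
    extendZero v m = v ⟨m, h⟩ := dif_pos h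

theorem extendZero_restrict {N : ℕ} (j : ∀ m, EndPi (Idx m ⊕ Idx m) E) {m : ℕ} (h : m < N) :
    j m = extendZero (fun m : Fin N => j m) m := by rw [extendZero_of_lt _ h]

theorem continuous_extendZero {N : ℕ} :
    Continuous (extendZero (E := E) (N := N)) := by
  refine continuous_pi fun m => ?_
  by_cases h : m < N
  · simp only [extendZero_of_lt _ h]; exact continuous_apply _
  · simp only [extendZero, dif_neg h]; exact continuous_const

section Graph

variable {U : Type*} [NonUnitalRing U] [Module ℂ U] (ρ : U →ₙₐ[ℂ] (E →L[ℂ] E))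

/-- The graph of `a ↦ (π_1(a), …, π_N(a))`. -/
def sobolevGraph (hR : ResolventData B D R Q) (hg : IsGradingOp D φ (diagPi (Idx 0) ε))
    (hρ : ∀ a, IsAdjointable B (diagPi (Idx 0) (ρ a))) (N : ℕ) :
    NonUnitalSubalgebra ℂ (U × (∀ m : Fin N, EndPi (Idx m ⊕ Idx m) E)) where
  carrier := {P | IsTower B D ε R Q N (ρ P.1) (extendZero P.2)}
  zero_mem' := by
    have h : IsTower B D ε R Q N 0 0 := .zero
    rw [← map_zero ρ] at h
    exact h.congr fun m hm => by rw [extendZero_of_lt _ hm]; rfl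
  add_mem' {P P'} h h' := by
    have := IsTower.add h h'
    rw [← map_add] at this
    exact this.congr fun m hm => by simp only [Pi.add_apply, extendZero_of_lt _ hm]; rfl
  mul_mem' {P P'} h h' := by
    have := IsTower.mul hR hg (hρ _) (hρ _) h h'
    rw [← map_mul] at this
    exact this.congr fun m hm => by simp only [Pi.mul_apply, extendZero_of_lt _ hm]; rfl
  smul_mem' c P h := by
    have := IsTower.smul h c
    rw [← map_smul] at this
    exact this.congr fun m hm => by simp only [Pi.smul_apply, extendZero_of_lt _ hm]; rfl

variable {ρ}

theorem fst_image_sobolevGraph (hR : ResolventData B D R Q)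
    (hg : IsGradingOp D φ (diagPi (Idx 0) ε))
    (hρ : ∀ a, IsAdjointable B (diagPi (Idx 0) (ρ a))) (N : ℕ) :
    Prod.fst '' (sobolevGraph ρ hR hg hρ N : Set (U × (∀ m : Fin N, EndPi (Idx m ⊕ Idx m) E))) =
      {a | ∃ j, IsTower B D ε R Q N (ρ a) j} := by
  ext a
  constructor
  · rintro ⟨P, hP, rfl⟩
    exact ⟨_, hP⟩
  · rintro ⟨j, hj⟩
    exact ⟨(a, fun m => j m), hj.congr fun m hm => extendZero_restrict j hm, rfl⟩

end Graph

theorem norm_diagPi_le (T : E →L[ℂ] E) : ‖diagPi (Idx 0) T‖ ≤ ‖T‖ :=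
  (diagPi (Idx 0) T).opNorm_le_bound (norm_nonneg _) fun x =>
    (pi_norm_le_iff_of_nonneg (by positivity)).2 fun i =>
      (T.le_opNorm _).trans (by gcongr; exact norm_le_pi_norm x i)

theorem diagPi_pow (T : E →L[ℂ] E) (n : ℕ) : diagPi (Idx 0) T ^ n = diagPi (Idx 0) (T ^ n) := by
  induction n with
  | zero => rfl
  | succ n ih => rw [pow_succ, ih, pow_succ]; rfl

section Unital

variable [CompleteSpace E] {U : Type*} [NormedRing U] [NormedAlgebra ℂ U] [CompleteSpace U]
  {ρ : U →ₙₐ[ℂ] (E →L[ℂ] E)}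

theorem powBound_rep (hb : ∀ a, ‖ρ a‖ ≤ ‖a‖) (a : U) {r : ℝ} (hr : ‖a‖ < r) :
    PowBound (diagPi (Idx 0) (ρ a)) r := by
  have hr0 : 0 < r := (norm_nonneg a).trans_lt hr
  -- The first summand covers the exponent `0`, as `ρ` need not be unital; the `1` covers positive
  -- exponents.
  refine ⟨‖diagPi (Idx 0) (1 : E →L[ℂ] E)‖ + 1, by positivity, fun n => ?_⟩
  rw [diagPi_pow]
  rcases n with _ | n
  · simp
  · have h1 : ρ a ^ (n + 1) = ρ (a ^ (n + 1)) := by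
      induction n with
      | zero => simp
      | succ n ih => rw [pow_succ, ih, pow_succ a (n + 1), map_mul]
    calc ‖diagPi (Idx 0) (ρ a ^ (n + 1))‖ ≤ ‖a ^ (n + 1)‖ := by
          rw [h1]; exact (norm_diagPi_le _).trans (hb _)
      _ ≤ ‖a‖ ^ (n + 1) := norm_pow_le' a n.succ_pos
      _ ≤ 1 * r ^ (n + 1) := by rw [one_mul]; gcongr
      _ ≤ _ := by gcongr; exact le_add_of_nonneg_left (norm_nonneg _)

/-- Growth, closedness and single-valuedness of `sobolevGraph` are the hypotheses of the abstract
criterion. `ρ` need only be contractive, so that one statement serves both a unital `A` and the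
unitization. -/
theorem holomorphicallyClosed_tower (hR : ResolventData B D R Q)
    (hg : IsGradingOp D φ (diagPi (Idx 0) ε))
    (hρ : ∀ a, IsAdjointable B (diagPi (Idx 0) (ρ a))) (hb : ∀ a, ‖ρ a‖ ≤ ‖a‖) (N : ℕ)
    (hd : Dense {a | ∃ j, IsTower B D ε R Q N (ρ a) j}) :
    HolomorphicallyClosed {a | ∃ j, IsTower B D ε R Q N (ρ a) j} := by
  rw [← fst_image_sobolevGraph hR hg hρ N] at hd ⊢
  have hcont : Continuous ρ := (LinearMap.mkContinuous (ρ : U →ₗ[ℂ] (E →L[ℂ] E)) 1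
    fun a => by rw [one_mul]; exact hb a).continuous
  refine HasPowerGrowth.holomorphicallyClosed (V := ∀ m : Fin N, EndPi (Idx m ⊕ Idx m) E)
    (G := sobolevGraph ρ hR hg hρ N) ?_ ?_ ?_ hd
  · intro c v hcv r hr
    have hpow : ∀ m : Fin N, PowBound (v m) r := fun m => by
      have := IsTower.powBound hR hg (hρ c) hcv (norm_nonneg c)
        (fun s hs => powBound_rep hb c hs) m m.2 r hr
      rwa [extendZero_of_lt _ m.2] at this
    choose C hC0 hC using hpow
    have hr0 : 0 < r := (norm_nonneg c).trans_lt hr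
    refine ⟨∑ m, C m, fun n => (pi_norm_le_iff_of_nonneg ?_).2 fun m => ?_⟩
    · exact mul_nonneg (Finset.sum_nonneg fun m _ => hC0 m) (by positivity)
    · refine (hC m n).trans ?_
      gcongr
      exact Finset.single_le_sum (fun m _ => hC0 m) (Finset.mem_univ m)
  · exact (isClosed_isTower (B := B) (ε := ε) hR N).preimage
      ((hcont.comp continuous_fst).prodMk (continuous_extendZero.comp continuous_snd))
  -- Over `a = 0` the zero family is a tower, and towers are unique.
  · intro v hv
    have h1 : IsTower B D ε R Q N 0 (extendZero v) := by
      have : IsTower B D ε R Q N (ρ 0) (extendZero v) := hv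
      rwa [map_zero] at this
    funext m
    have := h1.unique hR .zero m m.2
    rwa [extendZero_of_lt _ m.2] at this

end Unital

section One

variable {ι : Type*}

theorem Intertwines.mul {S T : EndPi ι E} (hS : Intertwines D 1 S) (hT : Intertwines D 1 T) :
    Intertwines D 1 (S * T) := fun x hx => by
  obtain ⟨h1, h2⟩ := hT x hx
  obtain ⟨h3, h4⟩ := hS _ h1
  refine ⟨h3, ?_⟩
  change opPi D (S (T x)) = (1 : ℂ) • S (T (opPi D x))
  rw [h4, h2, one_smul (M := ℂ) (T _)]

theorem Intertwines.add {S T : EndPi ι E} (hS : Intertwines D 1 S) (hT : Intertwines D 1 T) :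
    Intertwines D 1 (S + T) := fun x hx => by
  obtain ⟨h1, h2⟩ := hT x hx
  obtain ⟨h3, h4⟩ := hS x hx
  refine ⟨h3.add h1, ?_⟩
  rw [add_apply, opPi_add h3 h1, h2, h4, add_apply, smul_add]

theorem Intertwines.tri_self {T : EndPi ι E} (hT : Intertwines D 1 T) :
    Intertwines D 1 (tri T 0 T) := by
  simpa using hT.triDiag (d := 1)

theorem IsLevel.intertwines_compressPi [Fintype ι] (hR : ResolventData B D R Q)
    {σ q q' : EndPi ι E} (hL : IsLevel D φ σ q q') {π : EndPi (ι ⊕ ι) E}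
    (hπ : Intertwines D 1 π) : Intertwines D 1 (compressPi R Q q q' π) :=
  (((hR.intertwines_worPi.mul hL.intertwines_left.tri_self).mul hπ).mul
    (hR.intertwines_worPi.mul hL.intertwines_left.tri_self)).add
  (((hR.intertwines_worPi.one_sub.mul hL.intertwines_right.tri_self).mul hπ).mul
    (hR.intertwines_worPi.one_sub.mul hL.intertwines_right.tri_self))

theorem Intertwines.isCommutator [Fintype ι] {T : EndPi ι E} (hT : Intertwines D 1 T) :
    IsCommutator B D T T (0 : EndPi ι E) := by
  rw [isCommutator_iff]
  refine ⟨.zero, fun x hx => ?_⟩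
  obtain ⟨h1, h2⟩ := hT x hx
  exact ⟨h1, by rw [h2]; simp⟩

/-- In general `θ_n(1) ≠ 1`; for instance `θ_2(1) = p_2 p_1 + p_2^⊥ p_1^⊥`. But `θ_n(1)` is built
from projections that commute with `D`, so its commutator with `D` vanishes and the tower continues.
-/
theorem exists_isTower_one (hR : ResolventData B D R Q)
    (hg : IsGradingOp D φ (diagPi (Idx 0) ε)) (hε : ε * ε = 1) (n : ℕ) :
    ∃ j, IsTower B D ε R Q n 1 j ∧ Intertwines D 1 (thetaOf R Q 1 j n) := by
  induction n with
  | zero => exact ⟨0, fun m hm => absurd hm m.not_lt_zero, Intertwines.one⟩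
  | succ n ih =>
    obtain ⟨j, hj, hi⟩ := ih
    -- Since `ε 1 ε = 1`, the conjugate tower is another tower of `1`, and uniqueness applies.
    have hconj : gradIdx ε n * thetaOf R Q 1 j n * gradIdx ε n = thetaOf R Q 1 j n := by
      have h1 := hj.conj hR hg
      have h2 : ε * 1 * ε = 1 := by rw [mul_one, hε]
      rw [← thetaOf_conj hR hg, h2]
      rw [h2] at h1
      exact thetaOf_congr (h1.unique hR hj)
    have hπ : IsLift B D (gradIdx ε n) (thetaOf R Q 1 j n)
        (tri (thetaOf R Q 1 j n) 0 (thetaOf R Q 1 j n)) :=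
      ⟨0, by rw [hconj]; exact hi.isCommutator, by rw [hconj]⟩
    set π := tri (thetaOf R Q 1 j n) 0 (thetaOf R Q 1 j n) with hdef
    have hlt : ∀ m < n, j m = Function.update j n π m := fun m hm => by
      rw [Function.update_of_ne hm.ne]
    refine ⟨Function.update j n π, fun m hm => ?_, ?_⟩
    · rcases Nat.lt_succ_iff_lt_or_eq.1 hm with hm | rfl
      · exact (hj.congr hlt) m hm
      · rw [← thetaOf_congr hlt, Function.update_self]
        exact hπ
    · change Intertwines D 1 (compressPi R Q (projIdx R Q n) (coprojIdx R Q n)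
        (Function.update j n π n))
      rw [Function.update_self]
      exact (isLevel_idx hR hg n).intertwines_compressPi hR hi.tri_self

end One

end Representation

/-! ### Application to the cycle: unital `A` and the unitization -/

section Cycle

variable {A B E : Type*} [NonUnitalCStarAlgebra A]
  [NonUnitalCStarAlgebra B] [PartialOrder B] [StarOrderedRing B]
  [NormedAddCommGroup E] [NormedSpace ℂ E] [CompleteSpace E]
  [SMul Bᵐᵒᵖ E] [CStarModule Bᵐᵒᵖ E] {gA : Grading A} {gB : Grading B}

/-- The additive map of `Bᵐᵒᵖ` given by the grading automorphism of `B`. -/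
def Grading.opAut (gB : Grading B) : Bᵐᵒᵖ →+ Bᵐᵒᵖ where
  toFun x := MulOpposite.op (gB.aut (MulOpposite.unop x))
  map_zero' := by simp
  map_add' x y := by simp

theorem KKCycle.exists_gradCLM (c : KKCycle gA gB E) :
    ∃ ε : E →L[ℂ] E, ⇑ε = c.grad ∧ ε * ε = 1 ∧
      IsGradingOp c.D gB.opAut (diagPi (Idx 0) ε) := by
  have hnorm : ∀ x, ‖c.grad x‖ ≤ 1 * ‖x‖ := fun x => by
    rw [one_mul, CStarModule.norm_eq_sqrt_norm_inner_self (A := Bᵐᵒᵖ),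
      CStarModule.norm_eq_sqrt_norm_inner_self (A := Bᵐᵒᵖ) x, c.inner_grad, MulOpposite.norm_op]
    rw [show ‖gB.aut (MulOpposite.unop (inner Bᵐᵒᵖ x x))‖ = ‖MulOpposite.unop (inner Bᵐᵒᵖ x x)‖
      from NonUnitalStarAlgHom.norm_map gB.aut (EquivLike.injective gB.aut) _]
    rfl
  refine ⟨LinearMap.mkContinuous c.grad 1 hnorm, rfl, ?_, ?_, ?_, ?_⟩
  · exact ContinuousLinearMap.ext fun x => c.grad_grad x
  · exact ContinuousLinearMap.ext fun x => funext fun i => c.grad_grad (x i)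
  · intro x hx
    refine ⟨fun i => c.odd_mem _ (hx i), funext fun i => ?_⟩
    change opFun c.D (c.grad (x i)) = (-1 : ℂ) • c.grad (opFun c.D (x i))
    rw [opFun_of_mem (c.odd_mem _ (hx i)), opFun_of_mem (hx i), c.odd ⟨x i, hx i⟩ _ rfl, neg_one_smul]
  · intro x y
    rw [map_sum]
    exact Finset.sum_congr rfl fun i _ => c.inner_grad _ _

theorem isAdjointable_diagPi {T S : E →L[ℂ] E}
    (h : ∀ x y, inner Bᵐᵒᵖ (T x) y = inner Bᵐᵒᵖ x (S y)) :
    IsAdjointable B (diagPi (Idx 0) T) :=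
  ⟨diagPi (Idx 0) S, fun _ _ => Finset.sum_congr rfl fun _ _ => h _ _⟩

/-- The unital extension of the representation of `A` to the unitization of `A`. -/
noncomputable def Bimodule.repUnitization (M : Bimodule gA gB E) :
    Unitization ℂ A →ₐ[ℂ] (E →L[ℂ] E) := Unitization.lift M.rep

theorem Bimodule.repUnitization_apply (M : Bimodule gA gB E) (b : Unitization ℂ A) :
    M.repUnitization b = b.fst • 1 + M.rep b.snd := by
  change algebraMap ℂ (E →L[ℂ] E) b.fst + M.rep b.snd = _
  rw [Algebra.algebraMap_eq_smul_one]

theorem Bimodule.inner_repUnitization (M : Bimodule gA gB E) (b : Unitization ℂ A) (x y : E) :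
    inner Bᵐᵒᵖ (M.repUnitization b x) y = inner Bᵐᵒᵖ x (M.repUnitization (star b) y) := by
  rw [repUnitization_apply, repUnitization_apply]
  simp [M.inner_rep]

theorem Bimodule.norm_repUnitization_le (M : Bimodule gA gB E) (b : Unitization ℂ A) :
    ‖M.repUnitization b‖ ≤ ‖b‖ :=
  norm_rep_le (B := B) (M.repUnitization : Unitization ℂ A →ₙₐ[ℂ] (E →L[ℂ] E))
    (map_one M.repUnitization) M.inner_repUnitization b

/-- The representation may be degenerate, so the unital bound is applied to its extension to the
unitization, which contains `A` isometrically. -/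
theorem Bimodule.norm_rep_le (M : Bimodule gA gB E) (a : A) : ‖M.rep a‖ ≤ ‖a‖ := by
  have := M.norm_repUnitization_le (a : Unitization ℂ A)
  rw [repUnitization_apply, Unitization.norm_inr] at this
  simpa using this

theorem dense_unitization {S : Set A} (hS : Dense S) : Dense {b : Unitization ℂ A | b.snd ∈ S} := by
  have h := (dense_univ.prod hS).preimage
    (Unitization.uniformEquivProd (𝕜 := ℂ) (A := A)).toHomeomorph.isOpenMap
  exact h.mono fun b hb => hb.2

theorem KKCycle.holomorphicallyClosed_image (c : KKCycle gA gB E) {R Q ε : E →L[ℂ] E}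
    {φ : Bᵐᵒᵖ →+ Bᵐᵒᵖ} (hR : ResolventData B c.D R Q) (hg : IsGradingOp c.D φ (diagPi (Idx 0) ε))
    {n : ℕ} {S : Set A} (hS : S = {a | ∃ j, IsTower B c.D ε R Q n (c.rep a) j}) (hd : Dense S)
    {U : Type*} [CStarAlgebra U] (ψ : A ≃⋆ₐ[ℂ] U) : HolomorphicallyClosed (ψ '' S) := by
  obtain ⟨ρ, hρ⟩ : ∃ ρ : U →ₙₐ[ℂ] (E →L[ℂ] E), ∀ b, ρ b = c.rep (ψ.symm b) :=
    ⟨c.rep.comp (ψ.symm : U →ₙₐ[ℂ] A), fun b => rfl⟩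
  have himg : ψ '' S = {b | ∃ j, IsTower B c.D ε R Q n (ρ b) j} := by
    ext b
    simp only [Set.mem_ofPred_eq, hρ]
    subst hS
    constructor
    · rintro ⟨a, ha, rfl⟩
      rw [StarAlgEquiv.symm_apply_apply]
      exact ha
    · intro hb
      exact ⟨ψ.symm b, hb, by simp⟩
  have hiso : ∀ b : U, ‖ψ.symm b‖ = ‖b‖ := fun b =>
    NonUnitalStarAlgHom.norm_map ψ.symm (EquivLike.injective ψ.symm) b
  have hψ : ∀ a : A, ‖ψ a‖ = ‖a‖ := fun a =>
    NonUnitalStarAlgHom.norm_map ψ (EquivLike.injective ψ) a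
  have hd' : Dense (ψ '' S) := (EquivLike.surjective ψ).denseRange.dense_image
    (AddMonoidHomClass.isometry_of_norm ψ hψ).continuous hd
  rw [himg] at hd' ⊢
  refine holomorphicallyClosed_tower hR hg (fun b => ?_) (fun b => ?_) n hd'
  · rw [hρ]; exact isAdjointable_diagPi (c.inner_rep _)
  · rw [hρ, ← hiso]; exact c.norm_rep_le _

theorem KKCycle.holomorphicallyClosed_unitization (c : KKCycle gA gB E) {R Q ε : E →L[ℂ] E}
    {φ : Bᵐᵒᵖ →+ Bᵐᵒᵖ} (hR : ResolventData B c.D R Q) (hg : IsGradingOp c.D φ (diagPi (Idx 0) ε))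
    (hε : ε * ε = 1) {n : ℕ} {S : Set A}
    (hS : S = {a | ∃ j, IsTower B c.D ε R Q n (c.rep a) j}) (hd : Dense S) :
    HolomorphicallyClosed {b : Unitization ℂ A | b.snd ∈ S} := by
  obtain ⟨ρ, hρ⟩ : ∃ ρ : Unitization ℂ A →ₙₐ[ℂ] (E →L[ℂ] E), ∀ b, ρ b = c.repUnitization b :=
    ⟨(c.repUnitization : Unitization ℂ A →ₙₐ[ℂ] (E →L[ℂ] E)), fun b => rfl⟩
  obtain ⟨e, he, -⟩ := exists_isTower_one hR hg hε n
  -- Towers form a linear space that contains one of the identity, so adding a scalar multiple of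
  -- `1` to an operator does not affect the Sobolev condition.
  have himg : {b : Unitization ℂ A | b.snd ∈ S} = {b | ∃ j, IsTower B c.D ε R Q n (ρ b) j} := by
    ext b
    simp only [Set.mem_ofPred_eq, hρ, hS, c.repUnitization_apply]
    constructor
    · rintro ⟨j, hj⟩
      exact ⟨_, (he.smul b.fst).add hj⟩
    · rintro ⟨j, hj⟩
      have := (he.smul (-b.fst)).add hj
      rw [← add_assoc, neg_smul, neg_add_cancel, zero_add] at this
      exact ⟨_, this⟩
  have hd' := dense_unitization hd
  rw [himg] at hd' ⊢
  refine holomorphicallyClosed_tower hR hg (fun b => ?_) (fun b => ?_) n hd'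
  · rw [hρ]; exact isAdjointable_diagPi (c.inner_repUnitization b)
  · rw [hρ]; exact c.norm_repUnitization_le b

end Cycle

end KKSobolev

theorem mainTheorem4 {A B E : Type*} [NonUnitalCStarAlgebra A]
    [NonUnitalCStarAlgebra B] [PartialOrder B] [StarOrderedRing B]
    [NormedAddCommGroup E] [NormedSpace ℂ E] [CompleteSpace E]
    [SMul Bᵐᵒᵖ E] [CStarModule Bᵐᵒᵖ E]
    (gA : KKSobolev.Grading A) (gB : KKSobolev.Grading B) (c : KKSobolev.KKCycle gA gB E)
    (k : ℕ) (hk : c.IsCk k) (i : ℕ) (hi : i ≤ k) :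
    KKSobolev.IsHolomorphicallyStable (c.sobolev i) := by
  open KKSobolev in
  obtain ⟨R, Q, hR⟩ := c.selfAdjoint.exists_resolventData c.regular
  obtain ⟨ε, hε, hε2, hg⟩ := c.exists_gradCLM
  have hset : ∀ n, c.sobolev n = {a | ∃ j, IsTower B c.D ε R Q n (c.rep a) j} := fun n => by
    ext a
    change IsSobolev B c.grad c.D n (c.rep a) ↔ _
    rw [← hε, isSobolev_iff hR hg]
    rfl
  have hadj : ∀ a, IsAdjointable B (diagPi (Idx 0) (c.rep a)) := fun a =>
    isAdjointable_diagPi (c.inner_rep a)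
  -- The algebras decrease with the index, so density of `𝒜_k` gives density of `𝒜_i`.
  have hdense : Dense (c.sobolev i) := by
    refine Dense.mono ?_ hk
    rw [hset, hset]
    rintro a ⟨j, hj⟩
    exact ⟨j, hj.mono hi⟩
  refine ⟨?_, ?_, ?_⟩
  · refine ⟨(sobolevGraph c.rep hR hg hadj i).map (NonUnitalAlgHom.fst ℂ A _), ?_⟩
    rw [hset, ← fst_image_sobolevGraph hR hg hadj i]
    rfl
  · exact fun S _ ψ => c.holomorphicallyClosed_image hR hg (hset i) hdense ψ
  · exact c.holomorphicallyClosed_unitization hR hg hε2 (hset i) hdense
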